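/- **Theorem 2.4.** Let $W$ be a random variable with $W>0$ almost surely, $\mathbb E[W^4]<\infty$ and $\mathbb E[W^2]<\mathbb E[W]$. For $n\in\mathbb N$ let $W_1,\dots,W_n$ be independent copies of $W$, put $L_n=\sum_{i=1}^n W_i$, and let the generalised random graph on the vertex set $[n]=\{1,\dots,n\}$ be the random simple graph in which, conditionally on $W_1,\dots,W_n$, any two distinct vertices $i,j$ are joined by an edge independently of all other pairs with probability $\frac{W_iW_j}{W_iW_j+L_n}$. For $A\subseteq\mathbb N_{\ge3}=\{3,4,\dots\}$ let $\mathcal C_n(A)$ be the number of cycles of this graph whose length lies in $A$. Let $\eta$ be a Poisson point process on $\mathbb N_{\ge 3}$ whose intensity measure $\lambda$ is given by $$\lambda(\{k\})=\lambda_k=\frac1{2k}\left(\frac{\mathbb E[W^2]}{\mathbb E[W]}\right)^k,\qquad k\ge3 .$$ For two (almost surely) $\mathbb N_0$-valued random variables $X,Y$ let $d_{TV}(X,Y)=\sup_{B\subseteq\mathbb N_0}|\mathbb P(X\in B)-\mathbb P(Y\in B)|$. Then there exists a constant $C>0$ such that for all $n\ge3$ and all (possibly unbounded) $A\subseteq\mathbb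 N_{\ge3}$, $$d_{TV}\big(\mathcal C_n(A),\eta(A)\big)\le\frac{C\,(\log n)^3}{n}.$$ -/

import Mathlib

open MeasureTheory ProbabilityTheory
open scoped ENNReal NNReal

noncomputable section

namespace GenRandGraph

/-- Connection probability `w i * w j / (w i * w j + L)`, `L = ∑ l, w l`, of the vertices
`i`, `j` given the weights `w`. -/
def connProb {n : ℕ} (w : Fin n → ℝ) (i j : Fin n) : ℝ :=
  w i * w j / (w i * w j + ∑ l, w l)

open Classical in
/-- Conditional probability, given the weights `w`, that the random graph equals `H`, when each
unordered pair of distinct vertices is joined independently with probability `connProb`. -/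
def graphProb {n : ℕ} (w : Fin n → ℝ) (H : SimpleGraph (Fin n)) : ℝ :=
  ∏ e : Fin n × Fin n with e.1 < e.2,
    if H.Adj e.1 e.2 then connProb w e.1 e.2 else 1 - connProb w e.1 e.2

theorem measurable_connProb {n : ℕ} (i j : Fin n) :
    Measurable fun w : Fin n → ℝ => connProb w i j := by
  unfold connProb
  fun_prop

theorem measurable_graphProb {n : ℕ} (H : SimpleGraph (Fin n)) :
    Measurable fun w : Fin n → ℝ => graphProb w H := by
  unfold graphProb
  refine Finset.measurable_prod _ fun e _ => ?_
  split_ifs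
  · exact measurable_connProb _ _
  · exact measurable_const.sub (measurable_connProb _ _)

/-- The conditional law of the graph given the weights, as a kernel. -/
def graphKernel (n : ℕ) : Kernel (Fin n → ℝ) (SimpleGraph (Fin n)) where
  toFun w := Measure.sum fun H => ENNReal.ofReal (graphProb w H) • Measure.dirac H
  measurable' := by
    refine Measure.measurable_of_measurable_coe _ fun s hs => ?_
    simp only [Measure.sum_apply _ hs, Measure.smul_apply, smul_eq_mul]
    exact Measurable.tsum fun H =>
      ((measurable_graphProb H).ennreal_ofReal).mul_const _

/-- Law of the generalised random graph on `n` vertices whose weights are i.i.d. with law `μ`: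
first draw the weights, then draw the graph from `graphKernel n`. -/
def grgLaw (μ : Measure ℝ) (n : ℕ) : Measure (SimpleGraph (Fin n)) :=
  (Measure.pi fun _ : Fin n => μ).bind (graphKernel n)

/-- The possible cycles of length `m + 3` on the vertex set `Fin n`. The tuple
`(α 0, …, α (m + 2))` of distinct vertices stands for the cycle
`α 0 – α 1 – ⋯ – α (m + 2) – α 0`; it starts at its smallest vertex, and the condition
`α 1 < α (m + 2)` fixes the orientation, so that each cycle is listed exactly once. -/
def possibleCycles (n m : ℕ) : Set (Fin (m + 3) → Fin n) :=
  {α | Function.Injective α ∧ (∀ i, α 0 ≤ α i) ∧ α 1 < α (Fin.last (m + 2))}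

/-- The number of cycles of length `m + 3` in `G` (`i + 1` is cyclic on `Fin (m + 3)`). -/
def numCycles {n : ℕ} (G : SimpleGraph (Fin n)) (m : ℕ) : ℕ :=
  Set.ncard {α ∈ possibleCycles n m | ∀ i, G.Adj (α i) (α (i + 1))}

/-- The counting measure of the cycle lengths of `G`: `cycleProcess G A` is the number of
cycles of `G` whose length lies in `A`. -/
def cycleProcess {n : ℕ} (G : SimpleGraph (Fin n)) : Measure ℕ :=
  Measure.sum fun m : ℕ => (numCycles G m : ℝ≥0∞) • Measure.dirac (m + 3)

/-- The measure on `{3, 4, …}` with mass `(1 / (2 k)) (E[W ^ 2] / E[W]) ^ k` at `k`. -/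
def cycleIntensity {Ω : Type*} [MeasurableSpace Ω] (P : Measure Ω) (W : Ω → ℝ) : Measure ℕ :=
  Measure.sum fun m : ℕ =>
    ENNReal.ofReal (1 / (2 * ((m + 3 : ℕ) : ℝ)) * ((∫ ω, W ω ^ 2 ∂P) / ∫ ω, W ω ∂P) ^ (m + 3)) •
      Measure.dirac (m + 3)

/-- `η` is a Poisson point process with intensity measure `Λ`: a random measure such that
`η B` is Poisson distributed with parameter `Λ B` (almost surely infinite if `Λ B = ∞`) and the
values on pairwise disjoint sets are independent. -/
structure IsPoissonPointProcess {Ω E : Type*} [MeasurableSpace Ω] [MeasurableSpace E]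
    (P : Measure Ω) (Λ : Measure E) (η : Ω → Measure E) : Prop where
  measurable : Measurable η
  law : ∀ B : Set E, MeasurableSet B → Λ B ≠ ∞ →
    P.map (fun ω => η ω B) = (poissonMeasure (Λ B).toNNReal).map (fun k : ℕ => (k : ℝ≥0∞))
  law_top : ∀ B : Set E, MeasurableSet B → Λ B = ∞ → ∀ᵐ ω ∂P, η ω B = ∞
  indep : ∀ (r : ℕ) (B : Fin r → Set E), (∀ i, MeasurableSet (B i)) →
    Pairwise (fun i j => Disjoint (B i) (B j)) → iIndepFun (fun i ω => η ω (B i)) P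

/-- Total variation distance `sup_{B ⊆ ℕ} |P(X ∈ B) - Q(Y ∈ B)|` of two random variables that
are almost surely `ℕ`-valued (they are typed as extended nonnegative reals because they arise as
values of random counting measures). -/
def tvDist {Ω Ω' : Type*} [MeasurableSpace Ω] [MeasurableSpace Ω'] (P : Measure Ω)
    (X : Ω → ℝ≥0∞) (Q : Measure Ω') (Y : Ω' → ℝ≥0∞) : ℝ :=
  ⨆ B : Set ℕ, |P.real {ω | ∃ k ∈ B, X ω = (k : ℝ≥0∞)} - Q.real {ω | ∃ k ∈ B, Y ω = (k : ℝ≥0∞)}|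

end GenRandGraph

end

noncomputable section

namespace GenRandGraph

/-! ### Poisson expectations and Stein's equation -/

/-! Condition on the weights and write `L = ∑ w`, `S = ∑ w²`, `R = S / L`. While `R` stays below a
constant less than 1, the cycle count is nearly Poisson by the Stein–Chen method. Conditioning on
the presence of a cycle amounts to inserting its edges (`sum_graphProb_mul_ite_subset`), and this
raises the count by exactly one unless two vertices of the cycle are already connected in the graph
(`cycleCount_sup`). Such a connection between `a` and `b` has probability at most `w a * w b / L *
(1 - R)⁻¹` (`sum_graphProb_reachable_le`), so the Stein error is of order `pairCubes w / L ^ 3`,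
typically `1 / n`. The conditional mean is similarly close to `limitMean A R`, because the products
of `w² / L` over all `k`-tuples sum to exactly `R ^ k`.

The ratio `R` fluctuates around `ρ = m₂ / m₁` on the scale `n ^ (-1/2)`, so a Lipschitz estimate in
`R` would be too weak. Instead `x ↦ poissonExp g (limitMean A x)` is expanded to second order at
`ρ`, with constants uniform in `A` and `g` (`TaylorBound`). Up to quadratic errors the linear term
is a deterministic multiple of `S - ρ * L`, which has mean zero, and the quadratic errors have
expectation of order `1 / n` (`exists_abs_sub_sub_le_weightError`,
`integrable_integral_weightError_le`). Where `L` is too small or `S` too large, the squared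
deviations exceed a constant times `n ^ 2`, and the same error term absorbs the trivial bound.

The resulting rate is `C / n` (`exists_abs_integral_sub_le`); the factor `(log n)³` is slack, being
at least 1 for `n ≥ 3`. -/

/-- Expectation of `g` under the Poisson distribution with parameter `x`. -/
def poissonExp (g : ℕ → ℝ) (x : ℝ) : ℝ :=
  ∑' k : ℕ, g k * (Real.exp (-x) * (x ^ k / k.factorial))

theorem summable_mul_pow_div_factorial {u : ℕ → ℝ} {c : ℝ} (hu : ∀ k, |u k| ≤ c) (x : ℝ) :
    Summable fun k : ℕ => u k * (x ^ k / k.factorial) := by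
  refine Summable.of_norm_bounded
    (g := fun k : ℕ => c * (|x| ^ k / k.factorial))
    ((Real.summable_pow_div_factorial |x|).mul_left c) fun k => ?_
  rw [Real.norm_eq_abs, abs_mul, abs_div, abs_pow, Nat.abs_cast]
  exact mul_le_mul_of_nonneg_right (hu k) (by positivity)

theorem poissonExp_eq (g : ℕ → ℝ) (x : ℝ) :
    poissonExp g x = Real.exp (-x) * ∑' k : ℕ, g k * (x ^ k / k.factorial) := by
  rw [poissonExp, ← tsum_mul_left]
  congr 1
  ext k
  ring

theorem tsum_pow_div_factorial (x : ℝ) : ∑' k : ℕ, x ^ k / (k.factorial : ℝ) = Real.exp x := by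
  rw [Real.exp_eq_exp_ℝ, NormedSpace.exp_eq_tsum_div]

theorem abs_poissonExp_le {g : ℕ → ℝ} (hg : ∀ k, |g k| ≤ 1) {x : ℝ} (hx : 0 ≤ x) :
    |poissonExp g x| ≤ 1 := by
  rw [poissonExp_eq, abs_mul, Real.abs_exp, Real.exp_neg, inv_mul_le_iff₀ (Real.exp_pos x),
    mul_one, ← tsum_pow_div_factorial, ← Real.norm_eq_abs]
  refine tsum_of_norm_bounded (Real.summable_pow_div_factorial x).hasSum fun k => ?_
  rw [Real.norm_eq_abs, abs_mul, abs_of_nonneg (a := x ^ k / _) (by positivity)]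
  exact mul_le_of_le_one_left (by positivity) (hg k)

/-- The recursion is solved by the tail series `f k = -(k - 1)! ∑ j, u (k + j) x ^ j / (k + j)!`,
where `u` is `g` minus its Poisson mean. The bound is crude in `x`, which is harmless because all
means used later are bounded. -/
theorem exists_stein_solution {g : ℕ → ℝ} (hg : ∀ k, |g k| ≤ 1) {x : ℝ} (hx : 0 ≤ x) :
    ∃ f : ℕ → ℝ, (∀ k, |f k| ≤ 2 * Real.exp x) ∧
      ∀ k : ℕ, x * f (k + 1) - k * f k = g k - poissonExp g x := by
  set u : ℕ → ℝ := fun k => g k - poissonExp g x with hu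
  have hu2 : ∀ k, |u k| ≤ 2 := fun k => by
    have h1 := abs_sub (g k) (poissonExp g x)
    have h2 := abs_poissonExp_le hg hx
    have h3 := hg k
    simp only [hu]
    linarith
  set a : ℕ → ℝ := fun k => ∑' j : ℕ, u (k + j) * (x ^ j / (k + j).factorial) with ha
  have hbd : ∀ k j : ℕ, ‖u (k + j) * (x ^ j / (k + j).factorial)‖ ≤
      2 / k.factorial * (x ^ j / j.factorial) := fun k j => by
    have hfac : (k.factorial : ℝ) * j.factorial ≤ (k + j).factorial := by
      exact_mod_cast Nat.le_of_dvd (Nat.factorial_pos _)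
        (Nat.factorial_mul_factorial_dvd_factorial_add k j)
    rw [norm_mul, Real.norm_eq_abs, Real.norm_eq_abs,
      abs_of_nonneg (a := x ^ j / _) (by positivity)]
    calc |u (k + j)| * (x ^ j / (k + j).factorial)
        ≤ 2 * (x ^ j / (k.factorial * j.factorial)) := by
          gcongr
          exact hu2 _
      _ = 2 / k.factorial * (x ^ j / j.factorial) := by
          field_simp
  have hsum : ∀ k, Summable fun j : ℕ => u (k + j) * (x ^ j / (k + j).factorial) := fun k =>
    Summable.of_norm_bounded ((Real.summable_pow_div_factorial x).mul_left _) (hbd k)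
  have hale : ∀ k, |a k| ≤ 2 / k.factorial * Real.exp x := fun k => by
    rw [← Real.norm_eq_abs, ← tsum_pow_div_factorial, ← tsum_mul_left]
    exact tsum_of_norm_bounded ((Real.summable_pow_div_factorial x).mul_left _).hasSum (hbd k)
  have hrec : ∀ k, a k = u k / k.factorial + x * a (k + 1) := fun k => by
    simp only [ha]
    rw [(hsum k).tsum_eq_zero_add, ← tsum_mul_left]
    congr 1
    · simp [div_eq_mul_inv]
    · congr 1
      ext j
      rw [show k + (j + 1) = k + 1 + j by ring, pow_succ]
      ring
  -- This is the centring of `u`; it makes the equation hold at `k = 0`, where the term `k * f k`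
  -- drops out.
  have ha0 : a 0 = 0 := by
    have h1 : a 0 = ∑' j : ℕ, (g j * (x ^ j / j.factorial) -
        poissonExp g x * (x ^ j / j.factorial)) := by
      simp only [ha, hu, zero_add, sub_mul]
    rw [h1, (summable_mul_pow_div_factorial hg x).tsum_sub
      ((Real.summable_pow_div_factorial x).mul_left _), tsum_mul_left, tsum_pow_div_factorial,
      poissonExp_eq, mul_comm (Real.exp (-x)), mul_assoc, ← Real.exp_add]
    simp
  -- At `k = 0` the truncated subtraction gives an immaterial value of `f 0`.
  refine ⟨fun k => -((k - 1).factorial * a k), fun k => ?_, fun k => ?_⟩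
  · rw [abs_neg, abs_mul, Nat.abs_cast]
    calc ((k - 1).factorial : ℝ) * |a k| ≤ (k - 1).factorial * (2 / k.factorial * Real.exp x) := by
          gcongr
          exact hale k
      _ = (k - 1).factorial / k.factorial * (2 * Real.exp x) := by ring
      _ ≤ 1 * (2 * Real.exp x) := by
          gcongr
          rw [div_le_one (by positivity)]
          exact_mod_cast Nat.factorial_le (Nat.sub_le k 1)
      _ = 2 * Real.exp x := one_mul _
  · rcases k with _ | k
    · have := hrec 0
      rw [ha0] at this
      simp [hu] at this ⊢
      linarith
    · have h := hrec (k + 1)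
      have hf : ((k + 1).factorial : ℝ) = (k + 1) * k.factorial := by
        rw [Nat.factorial_succ]
        push_cast
        ring
      have hk : ((k + 1).factorial : ℝ) ≠ 0 := by positivity
      have h2 : (k + 1).factorial * a (k + 1) =
          u (k + 1) + (k + 1).factorial * (x * a (k + 2)) := by
        rw [h]
        field_simp
      change _ = u (k + 1)
      simp only [Nat.add_sub_cancel, Nat.cast_add, Nat.cast_one]
      rw [show (k + 1 + 1 : ℕ) = k + 2 from rfl]
      linear_combination h2 - a (k + 1) * hf

/-! ### Second-order Taylor bounds on an interval `[0, M]` -/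

/-- `f` and `f'` are bounded by `K` on `[0, M]`, and the first-order expansion of `f` with slope
`f'` has a quadratic error with constant `K`. -/
def TaylorBound (K M : ℝ) (f f' : ℝ → ℝ) : Prop :=
  ∀ x ∈ Set.Icc 0 M, ∀ y ∈ Set.Icc 0 M,
    |f x| ≤ K ∧ |f' y| ≤ K ∧ |f x - f y - f' y * (x - y)| ≤ K * (x - y) ^ 2

theorem TaylorBound.abs_sub_le {K M : ℝ} {f f' : ℝ → ℝ} (h : TaylorBound K M f f') {x y : ℝ}
    (hx : x ∈ Set.Icc 0 M) (hy : y ∈ Set.Icc 0 M) : |f x - f y| ≤ K * (1 + M) * |x - y| := by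
  obtain ⟨-, h2, h3⟩ := h x hx y hy
  have hK : 0 ≤ K := (abs_nonneg _).trans h2
  have hM : |x - y| ≤ M := abs_sub_le_iff.2 ⟨by linarith [hx.2, hy.1], by linarith [hy.2, hx.1]⟩
  calc |f x - f y| = |(f x - f y - f' y * (x - y)) + f' y * (x - y)| := by ring_nf
    _ ≤ |f x - f y - f' y * (x - y)| + |f' y * (x - y)| := abs_add_le _ _
    _ ≤ K * (x - y) ^ 2 + K * |x - y| := by
        rw [abs_mul]
        gcongr
    _ = K * |x - y| * |x - y| + K * |x - y| := by rw [← sq_abs]; ring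
    _ ≤ K * M * |x - y| + K * |x - y| := by gcongr
    _ = K * (1 + M) * |x - y| := by ring

/-- The constant `3 + M` collects 1 from each of the two remainders and `1 + M` from the product of
the first-order increments. -/
theorem TaylorBound.mul {K₁ K₂ M : ℝ} (hM : 0 ≤ M) {f f' g g' : ℝ → ℝ}
    (hf : TaylorBound K₁ M f f') (hg : TaylorBound K₂ M g g') :
    TaylorBound (K₁ * K₂ * (3 + M)) M (fun x => f x * g x)
      (fun x => f' x * g x + f x * g' x) := by
  intro x hx y hy
  obtain ⟨f1, f2, f3⟩ := hf x hx y hy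
  obtain ⟨g1, g2, g3⟩ := hg x hx y hy
  obtain ⟨f1', -, -⟩ := hf y hy y hy
  obtain ⟨g1', -, -⟩ := hg y hy y hy
  have hgs := hg.abs_sub_le hx hy
  have hK₁ : 0 ≤ K₁ := (abs_nonneg _).trans f1
  have hK₂ : 0 ≤ K₂ := (abs_nonneg _).trans g1
  have hK : 0 ≤ K₁ * K₂ := by positivity
  refine ⟨?_, ?_, ?_⟩
  · rw [abs_mul]
    calc |f x| * |g x| ≤ K₁ * K₂ := by gcongr
      _ ≤ K₁ * K₂ * (3 + M) := by nlinarith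
  · calc |f' y * g y + f y * g' y| ≤ |f' y| * |g y| + |f y| * |g' y| := by
          rw [← abs_mul, ← abs_mul]
          exact abs_add_le _ _
      _ ≤ K₁ * K₂ + K₁ * K₂ := by gcongr
      _ ≤ K₁ * K₂ * (3 + M) := by nlinarith
  · calc |f x * g x - f y * g y - (f' y * g y + f y * g' y) * (x - y)|
        = |(f x - f y - f' y * (x - y)) * g x + f y * (g x - g y - g' y * (x - y)) +
            f' y * (x - y) * (g x - g y)| := by ring_nf
      _ ≤ |f x - f y - f' y * (x - y)| * |g x| + |f y| * |g x - g y - g' y * (x - y)| +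
            |f' y| * |x - y| * |g x - g y| := by
          refine (abs_add_le _ _).trans (add_le_add ((abs_add_le _ _).trans ?_) ?_)
          · rw [abs_mul, abs_mul]
          · rw [abs_mul, abs_mul]
      _ ≤ K₁ * (x - y) ^ 2 * K₂ + K₁ * (K₂ * (x - y) ^ 2) +
            K₁ * |x - y| * (K₂ * (1 + M) * |x - y|) := by gcongr
      _ = K₁ * K₂ * (3 + M) * (x - y) ^ 2 := by
          rw [← sq_abs (x - y)]
          ring

theorem TaylorBound.comp {K₁ K₂ M N : ℝ} {f f' g g' : ℝ → ℝ}
    (hf : TaylorBound K₁ N f f') (hg : TaylorBound K₂ M g g')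
    (hmap : ∀ x ∈ Set.Icc 0 M, g x ∈ Set.Icc 0 N) :
    TaylorBound (K₁ * (1 + K₂ + (K₂ * (1 + M)) ^ 2)) M (fun x => f (g x))
      (fun x => f' (g x) * g' x) := by
  intro x hx y hy
  obtain ⟨f1, f2, f3⟩ := hf (g x) (hmap x hx) (g y) (hmap y hy)
  obtain ⟨g1, g2, g3⟩ := hg x hx y hy
  have hgs := hg.abs_sub_le hx hy
  have hK₁ : 0 ≤ K₁ := (abs_nonneg _).trans f1
  have hK₂ : 0 ≤ K₂ := (abs_nonneg _).trans g1
  have hK : 0 ≤ K₁ * K₂ := by positivity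
  have hK' : 0 ≤ K₁ * (K₂ * (1 + M)) ^ 2 := by positivity
  refine ⟨by nlinarith, ?_, ?_⟩
  · rw [abs_mul]
    calc |f' (g y)| * |g' y| ≤ K₁ * K₂ := by gcongr
      _ ≤ _ := by nlinarith
  · calc |f (g x) - f (g y) - f' (g y) * g' y * (x - y)|
        = |(f (g x) - f (g y) - f' (g y) * (g x - g y)) +
            f' (g y) * (g x - g y - g' y * (x - y))| := by ring_nf
      _ ≤ |f (g x) - f (g y) - f' (g y) * (g x - g y)| +
            |f' (g y)| * |g x - g y - g' y * (x - y)| := by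
          rw [← abs_mul]
          exact abs_add_le _ _
      _ ≤ K₁ * |g x - g y| ^ 2 + K₁ * (K₂ * (x - y) ^ 2) := by
          rw [sq_abs]
          gcongr
      _ ≤ K₁ * (K₂ * (1 + M) * |x - y|) ^ 2 + K₁ * (K₂ * (x - y) ^ 2) := by gcongr
      _ = (K₁ * K₂ + K₁ * (K₂ * (1 + M)) ^ 2) * (x - y) ^ 2 := by
          rw [mul_pow _ |x - y|, sq_abs]
          ring
      _ ≤ _ := by
          gcongr
          nlinarith

/-- Both estimates go by induction on the exponent; the remainder at one exponent is `y` times the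
previous remainder plus `(x - y)` times a difference of powers, which the first estimate controls.
-/
theorem abs_pow_sub_pow_sub_le {M x y : ℝ} (hx : x ∈ Set.Icc 0 M) (hy : y ∈ Set.Icc 0 M)
    (k : ℕ) :
    |x ^ (k + 1) - y ^ (k + 1)| ≤ (k + 1) * M ^ k * |x - y| ∧
    |x ^ (k + 2) - y ^ (k + 2) - (k + 2) * y ^ (k + 1) * (x - y)| ≤
      (k + 2) ^ 2 * M ^ k * (x - y) ^ 2 := by
  have hM : 0 ≤ M := hx.1.trans hx.2
  have ax : |x| ≤ M := by rw [abs_of_nonneg hx.1]; exact hx.2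
  have ay : |y| ≤ M := by rw [abs_of_nonneg hy.1]; exact hy.2
  have key : ∀ j : ℕ, |x ^ (j + 1) - y ^ (j + 1)| ≤ (j + 1) * M ^ j * |x - y| := by
    intro j
    induction j with
    | zero => simp
    | succ j ih =>
      calc |x ^ (j + 1 + 1) - y ^ (j + 1 + 1)|
          = |x * (x ^ (j + 1) - y ^ (j + 1)) + y ^ (j + 1) * (x - y)| := by ring_nf
        _ ≤ |x| * |x ^ (j + 1) - y ^ (j + 1)| + |y| ^ (j + 1) * |x - y| := by
            rw [← abs_mul, ← abs_pow, ← abs_mul]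
            exact abs_add_le _ _
        _ ≤ M * ((j + 1) * M ^ j * |x - y|) + M ^ (j + 1) * |x - y| := by gcongr
        _ = _ := by
            push_cast
            ring
  refine ⟨key k, ?_⟩
  induction k with
  | zero =>
    rw [show x ^ (0 + 2) - y ^ (0 + 2) - ((0 : ℕ) + 2) * y ^ (0 + 1) * (x - y) = (x - y) ^ 2 by
      push_cast; ring, abs_of_nonneg (sq_nonneg _)]
    norm_num
    nlinarith [sq_nonneg (x - y)]
  | succ k ih =>
    have h2 : ((k + 1 : ℕ) : ℝ) = k + 1 := by push_cast; ring
    calc |x ^ (k + 1 + 2) - y ^ (k + 1 + 2) -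
          ((k + 1 : ℕ) + 2) * y ^ (k + 1 + 1) * (x - y)|
        = |y * (x ^ (k + 2) - y ^ (k + 2) - (k + 2) * y ^ (k + 1) * (x - y)) +
            (x - y) * (x ^ (k + 1 + 1) - y ^ (k + 1 + 1))| := by
          rw [h2]
          ring_nf
      _ ≤ |y| * |x ^ (k + 2) - y ^ (k + 2) - (k + 2) * y ^ (k + 1) * (x - y)| +
            |x - y| * |x ^ (k + 1 + 1) - y ^ (k + 1 + 1)| := by
          rw [← abs_mul, ← abs_mul]
          exact abs_add_le _ _
      _ ≤ M * ((k + 2) ^ 2 * M ^ k * (x - y) ^ 2) +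
            |x - y| * (((k + 1 : ℕ) + 1) * M ^ (k + 1) * |x - y|) := by
          gcongr
          exact key (k + 1)
      _ = ((k + 2) ^ 2 + (k + 2)) * M ^ (k + 1) * (x - y) ^ 2 := by
          rw [← sq_abs (x - y), h2]
          ring
      _ ≤ _ := by
          rw [h2]
          gcongr
          nlinarith [(Nat.cast_nonneg k : (0 : ℝ) ≤ k)]

/-- Termwise application of the estimate for powers. The constant depends on the coefficients only
through the majorant `b`, which gives uniformity in `A` and `g`; the factors `1`, `M⁻¹`, `(M ^ 2)⁻¹`
account for the exponent lost in the value, the derivative and the remainder. -/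
theorem taylorBound_powerSeries {M : ℝ} (hM : 0 < M) {b : ℕ → ℝ} (hb : ∀ k, 0 ≤ b k)
    (hsum : Summable fun k : ℕ => b k * (k + 1) ^ 2 * M ^ k) {a : ℕ → ℝ}
    (hab : ∀ k, |a k| ≤ b k) :
    TaylorBound ((1 + M⁻¹ + (M ^ 2)⁻¹) * ∑' k : ℕ, b k * (k + 1) ^ 2 * M ^ k) M
      (fun x => ∑' k, a k * x ^ k) (fun x => ∑' k : ℕ, a k * (k * x ^ (k - 1))) := by
  have hiM : 0 < M⁻¹ := by positivity
  have hiM2 : 0 < (M ^ 2)⁻¹ := by positivity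
  set S := ∑' k : ℕ, b k * (k + 1) ^ 2 * M ^ k with hS
  have hS0 : 0 ≤ S := tsum_nonneg fun k => by have := hb k; positivity
  have b0 : ∀ x ∈ Set.Icc 0 M, ∀ k : ℕ, ‖a k * x ^ k‖ ≤ b k * (k + 1) ^ 2 * M ^ k := by
    intro x hx k
    rw [norm_mul, Real.norm_eq_abs, Real.norm_eq_abs, abs_pow, abs_of_nonneg hx.1]
    have hk : (1 : ℝ) ≤ (k + 1) ^ 2 := by nlinarith [(Nat.cast_nonneg k : (0 : ℝ) ≤ k)]
    calc |a k| * x ^ k ≤ b k * 1 * M ^ k := by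
          rw [mul_one]
          have := hb k
          have := hx.1
          gcongr
          · exact hab k
          · exact hx.2
      _ ≤ _ := by
          have := hb k
          gcongr
  have b1 : ∀ x ∈ Set.Icc 0 M, ∀ k : ℕ, ‖a k * (k * x ^ (k - 1))‖ ≤
      M⁻¹ * (b k * (k + 1) ^ 2 * M ^ k) := by
    intro x hx k
    have hbk := hb k
    rcases k with _ | k
    · simp
      positivity
    · rw [norm_mul, norm_mul, Real.norm_eq_abs, Real.norm_eq_abs, Real.norm_eq_abs, abs_pow,
        abs_of_nonneg hx.1, Nat.abs_cast, Nat.add_sub_cancel]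
      have hx0 := hx.1
      calc |a (k + 1)| * ((k + 1 : ℕ) * x ^ k) ≤ b (k + 1) * (((k + 1 : ℕ) + 1) ^ 2 * M ^ k) := by
            gcongr
            · exact hab _
            · push_cast
              nlinarith [(Nat.cast_nonneg k : (0 : ℝ) ≤ k)]
            · exact hx.2
        _ = _ := by
            rw [pow_succ M]
            field_simp
  have s0 : ∀ x ∈ Set.Icc 0 M, Summable fun k => a k * x ^ k := fun x hx =>
    Summable.of_norm_bounded hsum (b0 x hx)
  have s1 : ∀ x ∈ Set.Icc 0 M, Summable fun k : ℕ => a k * (k * x ^ (k - 1)) := fun x hx =>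
    Summable.of_norm_bounded (hsum.mul_left _) (b1 x hx)
  intro x hx y hy
  refine ⟨?_, ?_, ?_⟩
  · calc _ ≤ S := tsum_of_norm_bounded hsum.hasSum (b0 x hx)
      _ ≤ _ := by nlinarith [mul_nonneg hiM.le hS0, mul_nonneg hiM2.le hS0]
  · calc _ ≤ M⁻¹ * S := tsum_of_norm_bounded (hsum.hasSum.mul_left _) (b1 y hy)
      _ ≤ _ := by nlinarith [mul_nonneg hiM.le hS0, mul_nonneg hiM2.le hS0]
  · have e : (∑' k, a k * x ^ k) - (∑' k, a k * y ^ k) -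
        (∑' k : ℕ, a k * (k * y ^ (k - 1))) * (x - y) =
        ∑' k : ℕ, (a k * x ^ k - a k * y ^ k - a k * (k * y ^ (k - 1)) * (x - y)) := by
      rw [((s0 x hx).sub (s0 y hy)).tsum_sub ((s1 y hy).mul_right _),
        (s0 x hx).tsum_sub (s0 y hy), tsum_mul_right]
    rw [e]
    calc _ ≤ (M ^ 2)⁻¹ * (x - y) ^ 2 * S := by
          rw [← Real.norm_eq_abs]
          refine tsum_of_norm_bounded (hsum.hasSum.mul_left _) fun k => ?_
          have hbk := hb k
          rw [Real.norm_eq_abs, show a k * x ^ k - a k * y ^ k - a k * (k * y ^ (k - 1)) * (x - y)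
            = a k * (x ^ k - y ^ k - k * y ^ (k - 1) * (x - y)) by ring, abs_mul]
          rcases k with _ | _ | k
          · simp
            positivity
          · simp
            positivity
          · have h := (abs_pow_sub_pow_sub_le hx hy k).2
            have h2 : ((k + 1 + 1 : ℕ) : ℝ) = k + 2 := by push_cast; ring
            rw [h2, show k + 1 + 1 - 1 = k + 1 from rfl, show k + 1 + 1 = k + 2 from rfl]
            calc |a (k + 2)| * |x ^ (k + 2) - y ^ (k + 2) - (k + 2) * y ^ (k + 1) * (x - y)|
                ≤ b (k + 2) * ((k + 2 + 1) ^ 2 * M ^ k * (x - y) ^ 2) := by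
                  gcongr
                  · exact hab _
                  · refine h.trans ?_
                    have hk : ((k : ℝ) + 2) ^ 2 ≤ (k + 2 + 1) ^ 2 := by
                      nlinarith [(Nat.cast_nonneg k : (0 : ℝ) ≤ k)]
                    exact mul_le_mul_of_nonneg_right
                      (mul_le_mul_of_nonneg_right hk (by positivity)) (sq_nonneg _)
              _ = _ := by
                  rw [pow_add M]
                  field_simp
      _ = (M ^ 2)⁻¹ * S * (x - y) ^ 2 := by ring
      _ ≤ _ := by
          gcongr
          nlinarith [mul_nonneg hiM.le hS0, mul_nonneg hiM2.le hS0]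

theorem summable_sq_mul_pow_div_factorial (M : ℝ) :
    Summable fun k : ℕ => 1 / (k.factorial : ℝ) * (k + 1) ^ 2 * M ^ k := by
  refine Summable.of_norm_bounded (g := fun k : ℕ => 4 * ((4 * |M|) ^ k / k.factorial))
    ((Real.summable_pow_div_factorial _).mul_left 4) fun k => ?_
  have h1 : ((k : ℝ) + 1) ≤ 2 * 2 ^ k := by
    have : k + 1 ≤ 2 * 2 ^ k := by
      have := k.lt_two_pow_self
      omega
    exact_mod_cast this
  have h2 : ((k : ℝ) + 1) ^ 2 ≤ 4 * 4 ^ k := by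
    calc ((k : ℝ) + 1) ^ 2 ≤ (2 * 2 ^ k) ^ 2 := by gcongr
      _ = 4 * 4 ^ k := by
        rw [mul_pow, ← pow_mul, mul_comm k 2, pow_mul]
        norm_num
  rw [norm_mul, norm_mul, norm_pow, norm_pow, Real.norm_eq_abs, Real.norm_eq_abs, Real.norm_eq_abs,
    abs_of_nonneg (a := (1 : ℝ) / k.factorial) (by positivity),
    abs_of_nonneg (a := (k : ℝ) + 1) (by positivity)]
  calc 1 / (k.factorial : ℝ) * (k + 1) ^ 2 * |M| ^ k
      ≤ 1 / (k.factorial : ℝ) * (4 * 4 ^ k) * |M| ^ k := by gcongr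
    _ = _ := by
      rw [mul_pow]
      ring

/-- The Poisson expectation is `exp (-x)` times a power series, and both factors have coefficients
dominated by `1 / k!`, whatever `g` is. -/
theorem exists_taylorBound_poissonExp {M : ℝ} (hM : 0 < M) :
    ∃ K, ∀ g : ℕ → ℝ, (∀ k, |g k| ≤ 1) → ∃ g', TaylorBound K M (poissonExp g) g' := by
  have hs := summable_sq_mul_pow_div_factorial M
  have hb : ∀ k : ℕ, (0 : ℝ) ≤ 1 / k.factorial := fun k => by positivity
  have h1 := taylorBound_powerSeries hM hb hs (a := fun k => (-1) ^ k / k.factorial) fun k => by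
    rw [abs_div, abs_pow, abs_neg, abs_one, one_pow, Nat.abs_cast]
  set C := (1 + M⁻¹ + (M ^ 2)⁻¹) * ∑' k : ℕ, 1 / (k.factorial : ℝ) * (k + 1) ^ 2 * M ^ k
  refine ⟨C * C * (3 + M), fun g hg => ?_⟩
  have h2 := taylorBound_powerSeries hM hb hs (a := fun k => g k / k.factorial) fun k => by
    rw [abs_div, Nat.abs_cast]
    gcongr
    exact hg k
  have h := h1.mul hM.le h2
  have e : poissonExp g = fun x => (∑' k : ℕ, (-1) ^ k / (k.factorial : ℝ) * x ^ k) *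
      ∑' k : ℕ, g k / k.factorial * x ^ k := by
    ext x
    rw [poissonExp_eq, ← tsum_pow_div_factorial]
    congr 2
    · ext k
      rw [neg_pow]
      ring
    · ext k
      ring
  rw [e]
  exact ⟨_, h⟩

theorem summable_sq_mul_geometric {M : ℝ} (h0 : 0 < M) (h1 : M < 1) :
    Summable fun k : ℕ => ((k : ℝ) + 1) ^ 2 * M ^ k := by
  have h := (summable_pow_mul_geometric_of_norm_lt_one 2
    (r := M) (by rwa [Real.norm_eq_abs, abs_of_pos h0]))
  have h' := ((summable_nat_add_iff 1).2 h).mul_left M⁻¹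
  refine h'.congr fun k => ?_
  push_cast
  rw [pow_succ M]
  field_simp

theorem exists_taylorBound_of_coeff_le_one {M : ℝ} (h0 : 0 < M) (h1 : M < 1) :
    ∃ K, ∀ a : ℕ → ℝ, (∀ k, |a k| ≤ 1) →
      ∃ f', TaylorBound K M (fun x => ∑' k, a k * x ^ k) f' :=
  ⟨_, fun _ ha => ⟨_, taylorBound_powerSeries h0 (b := fun _ => 1) (fun _ => zero_le_one)
    (by simpa using summable_sq_mul_geometric h0 h1) ha⟩⟩

variable {n m l : ℕ}

/-! ### Expectations of functions of the random graph given the weights -/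


theorem connProb_comm (w : Fin n → ℝ) (i j : Fin n) : connProb w i j = connProb w j i := by
  rw [connProb, connProb, mul_comm (w i)]

/-- The connection probability as a function of the unordered pair. -/
def edgeProb (w : Fin n → ℝ) : Sym2 (Fin n) → ℝ :=
  Sym2.lift ⟨connProb w, connProb_comm w⟩

@[simp]
theorem edgeProb_mk (w : Fin n → ℝ) (i j : Fin n) : edgeProb w s(i, j) = connProb w i j := rfl

theorem connProb_nonneg {w : Fin n → ℝ} (hw : ∀ i, 0 < w i) (i j : Fin n) :
    0 ≤ connProb w i j := by
  have := hw i
  have := hw j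
  have : 0 ≤ ∑ l, w l := Finset.sum_nonneg fun l _ => (hw l).le
  unfold connProb
  positivity

theorem connProb_le_one {w : Fin n → ℝ} (hw : ∀ i, 0 < w i) (i j : Fin n) :
    connProb w i j ≤ 1 := by
  have := mul_pos (hw i) (hw j)
  have : 0 ≤ ∑ l, w l := Finset.sum_nonneg fun l _ => (hw l).le
  unfold connProb
  exact div_le_one_of_le₀ (by linarith) (by positivity)

theorem sum_weights_pos {w : Fin n → ℝ} (hw : ∀ i, 0 < w i) (i : Fin n) : 0 < ∑ l, w l :=
  Finset.sum_pos (fun l _ => hw l) ⟨i, Finset.mem_univ i⟩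

theorem connProb_le_div {w : Fin n → ℝ} (hw : ∀ i, 0 < w i) (i j : Fin n) :
    connProb w i j ≤ w i * w j / ∑ l, w l := by
  have := mul_pos (hw i) (hw j)
  have := sum_weights_pos hw i
  unfold connProb
  gcongr
  linarith

theorem edgeProb_nonneg {w : Fin n → ℝ} (hw : ∀ i, 0 < w i) (e : Sym2 (Fin n)) :
    0 ≤ edgeProb w e := by
  induction e with
  | h i j => exact connProb_nonneg hw i j

theorem graphProb_nonneg {w : Fin n → ℝ} (hw : ∀ i, 0 < w i) (H : SimpleGraph (Fin n)) :
    0 ≤ graphProb w H := by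
  unfold graphProb
  refine Finset.prod_nonneg fun e _ => ?_
  split_ifs
  · exact connProb_nonneg hw _ _
  · linarith [connProb_le_one hw e.1 e.2]

/-- Expanding `∏ (p + (1 - p)) = 1` gives one term per set of pairs `a < b`, that is, per graph. -/
theorem sum_graphProb (w : Fin n → ℝ) : ∑ H : SimpleGraph (Fin n), graphProb w H = 1 := by
  classical
  set E : Finset (Fin n × Fin n) := Finset.univ.filter fun e => e.1 < e.2 with hE
  have h1 : (1 : ℝ) = ∏ e ∈ E, (connProb w e.1 e.2 + (1 - connProb w e.1 e.2)) := by simp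
  rw [h1, Finset.prod_add]
  refine Finset.sum_nbij' (fun H => E.filter fun e => H.Adj e.1 e.2)
    (fun t => SimpleGraph.fromRel fun a b => (a, b) ∈ t) ?_ ?_ ?_ ?_ ?_
  · intro H _
    simp
  · simp
  · intro H _
    ext a b
    simp only [SimpleGraph.fromRel_adj, Finset.mem_filter, hE, Finset.mem_univ, true_and]
    constructor
    · rintro ⟨-, h | h⟩
      · exact h.2
      · exact h.2.symm
    · intro h
      refine ⟨h.ne, ?_⟩
      rcases lt_or_gt_of_ne h.ne with h' | h'
      · exact Or.inl ⟨h', h⟩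
      · exact Or.inr ⟨h', h.symm⟩
  · intro t ht
    have ht' := Finset.mem_powerset.1 ht
    ext ⟨a, b⟩
    simp only [SimpleGraph.fromRel_adj, Finset.mem_filter, hE, Finset.mem_univ, true_and]
    constructor
    · rintro ⟨h1, h2, h3 | h3⟩
      · exact h3
      · have := ht' h3
        simp only [hE, Finset.mem_filter, Finset.mem_univ, true_and] at this
        exact absurd h1 this.asymm
    · intro h
      have := ht' h
      simp only [hE, Finset.mem_filter, Finset.mem_univ, true_and] at this
      exact ⟨this, this.ne, Or.inl h⟩
  · intro H _
    unfold graphProb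
    rw [Finset.prod_ite]
    congr 1
    refine Finset.prod_congr ?_ fun _ _ => rfl
    ext e
    simp only [hE, Finset.mem_filter, Finset.mem_sdiff]
    tauto

/-- Independence of a single pair from all others: `r` is the common weight of the remaining pairs.
-/
theorem exists_graphProb_eq (w : Fin n → ℝ) {a b : Fin n} (hab : a ≠ b)
    {H : SimpleGraph (Fin n)} (hH : ¬ H.Adj a b) :
    ∃ r, graphProb w H = (1 - connProb w a b) * r ∧
      graphProb w (H ⊔ SimpleGraph.edge a b) = connProb w a b * r := by
  classical
  wlog hlt : a < b generalizing a b
  · have := this hab.symm (fun h => hH h.symm) ((not_lt.1 hlt).lt_of_ne hab.symm)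
    rwa [connProb_comm w a b, SimpleGraph.edge_comm a b]
  have hmem : (a, b) ∈ Finset.univ.filter fun e : Fin n × Fin n => e.1 < e.2 := by simpa using hlt
  refine ⟨∏ e ∈ (Finset.univ.filter fun e : Fin n × Fin n => e.1 < e.2).erase (a, b),
    if H.Adj e.1 e.2 then connProb w e.1 e.2 else 1 - connProb w e.1 e.2, ?_, ?_⟩
  · rw [graphProb, ← Finset.mul_prod_erase _ _ hmem, if_neg hH]
  · rw [graphProb, ← Finset.mul_prod_erase _ _ hmem, if_pos]
    · congr 1
      refine Finset.prod_congr rfl fun e he => ?_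
      have h1 : (H ⊔ SimpleGraph.edge a b).Adj e.1 e.2 ↔ H.Adj e.1 e.2 := by
        rw [Finset.mem_erase, Finset.mem_filter] at he
        rw [SimpleGraph.sup_adj, SimpleGraph.edge_adj]
        constructor
        · rintro (h | ⟨⟨h1, h2⟩ | ⟨h1, h2⟩, -⟩)
          · exact h
          · exact absurd (Prod.ext h1 h2) he.1
          · have := he.2.2
            rw [h1, h2] at this
            exact absurd hlt this.asymm
        · exact Or.inl
      simp only [h1]
    · rw [SimpleGraph.sup_adj, SimpleGraph.edge_adj]
      exact Or.inr ⟨Or.inl ⟨rfl, rfl⟩, hab⟩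

open Classical in
theorem sum_eq_sum_not_adj {a b : Fin n} (hab : a ≠ b) (F : SimpleGraph (Fin n) → ℝ) :
    ∑ H, F H = ∑ H with ¬ H.Adj a b, (F H + F (H ⊔ SimpleGraph.edge a b)) := by
  rw [← Finset.sum_filter_not_add_sum_filter _ (fun H : SimpleGraph (Fin n) => H.Adj a b),
    Finset.sum_add_distrib]
  congr 1
  symm
  have key : ∀ x y : Fin n, (SimpleGraph.edge a b).Adj x y ↔ s(x, y) = s(a, b) := by
    intro x y
    rw [SimpleGraph.edge_adj, Sym2.eq_iff]
    constructor
    · rintro ⟨⟨rfl, rfl⟩ | ⟨rfl, rfl⟩, -⟩ <;> simp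
    · rintro (⟨rfl, rfl⟩ | ⟨rfl, rfl⟩)
      · exact ⟨by simp, hab⟩
      · exact ⟨by simp, hab.symm⟩
  refine Finset.sum_nbij' (fun H => H ⊔ SimpleGraph.edge a b) (fun H => H \ SimpleGraph.edge a b)
    ?_ ?_ ?_ ?_ fun _ _ => rfl
  · intro H _
    simp [key]
  · intro H _
    simp [key]
  · intro H hH
    simp only [Finset.mem_filter, Finset.mem_univ, true_and] at hH
    ext x y
    simp only [SimpleGraph.sdiff_adj, SimpleGraph.sup_adj, key]
    have : s(x, y) = s(a, b) → ¬ H.Adj x y := by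
      intro h h'
      rw [← SimpleGraph.mem_edgeSet, h] at h'
      exact hH h'
    tauto
  · intro H hH
    simp only [Finset.mem_filter, Finset.mem_univ, true_and] at hH
    ext x y
    simp only [SimpleGraph.sdiff_adj, SimpleGraph.sup_adj, key]
    have : s(x, y) = s(a, b) → H.Adj x y := by
      intro h
      rw [← SimpleGraph.mem_edgeSet, h]
      exact hH
    tauto

open Classical in
theorem sum_graphProb_mul_ite_adj (w : Fin n → ℝ) {a b : Fin n} (hab : a ≠ b)
    (φ : SimpleGraph (Fin n) → ℝ) :
    ∑ H, graphProb w H * (if H.Adj a b then φ H else 0) =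
      connProb w a b * ∑ H, graphProb w H * φ (H ⊔ SimpleGraph.edge a b) := by
  rw [sum_eq_sum_not_adj hab, sum_eq_sum_not_adj hab
    (fun H => graphProb w H * φ (H ⊔ SimpleGraph.edge a b)), Finset.mul_sum]
  refine Finset.sum_congr rfl fun H hH => ?_
  simp only [Finset.mem_filter, Finset.mem_univ, true_and] at hH
  obtain ⟨r, h1, h2⟩ := exists_graphProb_eq w hab hH
  rw [if_neg hH, if_pos (show (H ⊔ SimpleGraph.edge a b).Adj a b from
      Or.inr ((SimpleGraph.edge_adj a b a b).2 ⟨Or.inl ⟨rfl, rfl⟩, hab⟩)), h1, h2, sup_assoc,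
    sup_idem]
  ring

open Classical in
/-- Conditioning on the presence of the edges in `T` amounts to inserting them. -/
theorem sum_graphProb_mul_ite_subset (w : Fin n → ℝ) (T : Finset (Sym2 (Fin n)))
    (hT : ∀ e ∈ T, ¬ e.IsDiag) (φ : SimpleGraph (Fin n) → ℝ) :
    ∑ H, graphProb w H * (if (T : Set (Sym2 (Fin n))) ⊆ H.edgeSet then φ H else 0) =
      (∏ e ∈ T, edgeProb w e) *
        ∑ H, graphProb w H * φ (H ⊔ SimpleGraph.fromEdgeSet (T : Set (Sym2 (Fin n)))) := by
  induction T using Finset.induction_on generalizing φ with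
  | empty => simp
  | insert e T he ih =>
    have hT' : ∀ e ∈ T, ¬ e.IsDiag := fun e h => hT e (Finset.mem_insert_of_mem h)
    have hd := hT e (Finset.mem_insert_self e T)
    induction e with
    | h a b =>
      have hab : a ≠ b := by simpa using hd
      have h1 : ∀ H : SimpleGraph (Fin n),
          (if ((insert s(a, b) T : Finset _) : Set (Sym2 (Fin n))) ⊆ H.edgeSet then φ H else 0) =
          if (T : Set (Sym2 (Fin n))) ⊆ H.edgeSet then (if H.Adj a b then φ H else 0) else 0 := by
        intro H
        simp only [Finset.coe_insert, Set.insert_subset_iff, SimpleGraph.mem_edgeSet]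
        split_ifs <;> tauto
      have h2 : ∀ H : SimpleGraph (Fin n),
          (H ⊔ SimpleGraph.fromEdgeSet (T : Set (Sym2 (Fin n)))).Adj a b ↔ H.Adj a b := by
        intro H
        simp only [SimpleGraph.sup_adj, SimpleGraph.fromEdgeSet_adj, Finset.mem_coe]
        tauto
      simp only [h1]
      rw [ih hT', Finset.prod_insert he, edgeProb_mk]
      simp only [h2]
      rw [sum_graphProb_mul_ite_adj w hab, Finset.coe_insert, Set.insert_eq,
        SimpleGraph.fromEdgeSet_union]
      simp only [SimpleGraph.edge, sup_assoc]
      ring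

open Classical in
theorem sum_graphProb_subset (w : Fin n → ℝ) (T : Finset (Sym2 (Fin n)))
    (hT : ∀ e ∈ T, ¬ e.IsDiag) :
    ∑ H, graphProb w H * (if (T : Set (Sym2 (Fin n))) ⊆ H.edgeSet then 1 else 0) =
      ∏ e ∈ T, edgeProb w e := by
  rw [sum_graphProb_mul_ite_subset w T hT fun _ => 1]
  simp [sum_graphProb]

/-! ### Connection probabilities -/

/-- The bound `w i * w j / L` for the connection probability, as a function of the unordered
pair. -/
def edgeBound (w : Fin n → ℝ) : Sym2 (Fin n) → ℝ :=
  Sym2.lift ⟨fun i j => w i * w j / ∑ l, w l, fun i j => by simp only [mul_comm (w i)]⟩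

@[simp]
theorem edgeBound_mk (w : Fin n → ℝ) (i j : Fin n) :
    edgeBound w s(i, j) = w i * w j / ∑ l, w l := rfl

theorem edgeProb_le_edgeBound {w : Fin n → ℝ} (hw : ∀ i, 0 < w i) (e : Sym2 (Fin n)) :
    edgeProb w e ≤ edgeBound w e := by
  induction e with
  | h i j => exact connProb_le_div hw i j

theorem edgeBound_nonneg {w : Fin n → ℝ} (hw : ∀ i, 0 < w i) (e : Sym2 (Fin n)) :
    0 ≤ edgeBound w e :=
  (edgeProb_nonneg hw e).trans (edgeProb_le_edgeBound hw e)

/-- Each interior vertex `v` of a walk lies on two steps and contributes `w v ^ 2 / L`; summing over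
its position gives one factor `R`. The induction peels off the first step. -/
theorem sum_finsetWalkLength_le {w : Fin n → ℝ} (hw : ∀ i, 0 < w i) (b : Fin n) (j : ℕ)
    (a : Fin n) :
    ∑ p ∈ (⊤ : SimpleGraph (Fin n)).finsetWalkLength (j + 1) a b,
        (p.edges.map (edgeBound w)).prod ≤
      w a * w b / (∑ l, w l) * ((∑ l, w l ^ 2) / ∑ l, w l) ^ j := by
  classical
  have hL := sum_weights_pos hw a
  have hnn : ∀ (v : Fin n) (p : (⊤ : SimpleGraph (Fin n)).Walk v b),
      0 ≤ (p.edges.map (edgeBound w)).prod := fun v p =>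
    List.prod_nonneg (by
      intro x hx
      obtain ⟨e, -, rfl⟩ := List.mem_map.1 hx
      exact edgeBound_nonneg hw e)
  have step : ∀ j : ℕ, ∀ a : Fin n,
      ∑ p ∈ (⊤ : SimpleGraph (Fin n)).finsetWalkLength (j + 1) a b,
        (p.edges.map (edgeBound w)).prod ≤
      ∑ v : Fin n, w a * w v / (∑ l, w l) *
        ∑ p ∈ (⊤ : SimpleGraph (Fin n)).finsetWalkLength j v b,
          (p.edges.map (edgeBound w)).prod := by
    intro j a
    rw [SimpleGraph.finsetWalkLength, Finset.sum_biUnion]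
    · set F : Fin n → ℝ := fun v => w a * w v / (∑ l, w l) *
        ∑ p ∈ (⊤ : SimpleGraph (Fin n)).finsetWalkLength j v b,
          (p.edges.map (edgeBound w)).prod
      -- The terms are nonnegative, so the second vertex may range over all of `Fin n`, including
      -- `a`.
      have e2 : ∑ v : (⊤ : SimpleGraph (Fin n)).neighborSet a, F v ≤ ∑ v, F v := by
        refine (Finset.sum_map Finset.univ (Function.Embedding.subtype _) F).symm.trans_le ?_
        refine Finset.sum_le_univ_sum_of_nonneg fun v => ?_
        have := hw a
        have := hw v
        have := Finset.sum_nonneg fun p (_ : p ∈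
          (⊤ : SimpleGraph (Fin n)).finsetWalkLength j v b) => hnn v p
        positivity
      refine le_trans (le_of_eq (Finset.sum_congr rfl ?_)) e2
      intro v _
      rw [Finset.sum_map]
      refine Eq.trans (Finset.sum_congr rfl fun p _ => ?_) (Finset.mul_sum _ _ _).symm
      have hv : (⊤ : SimpleGraph (Fin n)).Adj a v := v.property
      change ((SimpleGraph.Walk.cons hv p).edges.map (edgeBound w)).prod = _
      rw [SimpleGraph.Walk.edges_cons, List.map_cons, List.prod_cons, edgeBound_mk]
    · intro v _ v' _ hvv
      rw [Function.onFun, Finset.disjoint_left]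
      intro p hp hp'
      obtain ⟨q, -, rfl⟩ := Finset.mem_map.1 hp
      obtain ⟨q', -, h⟩ := Finset.mem_map.1 hp'
      have hv : (⊤ : SimpleGraph (Fin n)).Adj a v := v.property
      have hv' : (⊤ : SimpleGraph (Fin n)).Adj a v' := v'.property
      have h' : (SimpleGraph.Walk.cons hv' q').snd = (SimpleGraph.Walk.cons hv q).snd :=
        congrArg SimpleGraph.Walk.snd h
      rw [SimpleGraph.Walk.snd_cons, SimpleGraph.Walk.snd_cons] at h'
      exact hvv (Subtype.ext h'.symm)
  induction j generalizing a with
  | zero =>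
    refine (step 0 a).trans ?_
    rw [Finset.sum_eq_single b]
    · simp [SimpleGraph.finsetWalkLength]
    · intro v _ hv
      simp [SimpleGraph.finsetWalkLength, hv]
    · simp
  | succ j ih =>
    refine (step (j + 1) a).trans ?_
    calc _ ≤ ∑ v : Fin n, w a * w v / (∑ l, w l) *
          (w v * w b / (∑ l, w l) * ((∑ l, w l ^ 2) / ∑ l, w l) ^ j) := by
          refine Finset.sum_le_sum fun v _ => ?_
          have := hw a
          have := hw v
          exact mul_le_mul_of_nonneg_left (ih v) (by positivity)
      _ = ∑ v : Fin n, w v ^ 2 *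
          (w a * w b / (∑ l, w l) / (∑ l, w l) * ((∑ l, w l ^ 2) / ∑ l, w l) ^ j) :=
          Finset.sum_congr rfl fun v _ => by ring
      _ = _ := by
          rw [← Finset.sum_mul, pow_succ]
          ring

open Classical in
-- Union bound over the paths from `a` to `b`. A path has distinct edges, so its probability is a
-- product of edge probabilities; summing over the length gives a geometric series in `R`.
theorem sum_graphProb_reachable_le {w : Fin n → ℝ} (hw : ∀ i, 0 < w i)
    (hR : (∑ l, w l ^ 2) / ∑ l, w l < 1) {a b : Fin n} (hab : a ≠ b) :
    ∑ H, graphProb w H * (if H.Reachable a b then 1 else 0) ≤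
      w a * w b / (∑ l, w l) * (1 - (∑ l, w l ^ 2) / ∑ l, w l)⁻¹ := by
  set R := (∑ l, w l ^ 2) / ∑ l, w l with hRdef
  have hL := sum_weights_pos hw a
  have hwa := hw a
  have hwb := hw b
  have hR0 : 0 ≤ R := div_nonneg (Finset.sum_nonneg fun _ _ => sq_nonneg _) hL.le
  set K : SimpleGraph (Fin n) := ⊤
  have h1 : ∀ H : SimpleGraph (Fin n), (if H.Reachable a b then (1 : ℝ) else 0) ≤
      ∑ j ∈ Finset.range n, ∑ p ∈ K.finsetWalkLength (j + 1) a b with p.IsPath,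
        if (p.edges.toFinset : Set (Sym2 (Fin n))) ⊆ H.edgeSet then 1 else 0 := by
    intro H
    have hnn : ∀ j ∈ Finset.range n,
        (0 : ℝ) ≤ ∑ p ∈ K.finsetWalkLength (j + 1) a b with p.IsPath,
          if (p.edges.toFinset : Set (Sym2 (Fin n))) ⊆ H.edgeSet then 1 else 0 := fun j _ =>
      Finset.sum_nonneg fun p _ => by split_ifs <;> norm_num
    split_ifs with h
    · obtain ⟨p, hp⟩ := h.exists_isPath
      have hlen : p.length < n := by simpa using hp.length_lt
      have hlen0 : p.length ≠ 0 := fun h0 => hab (SimpleGraph.Walk.eq_of_length_eq_zero h0)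
      obtain ⟨j, hj⟩ := Nat.exists_eq_succ_of_ne_zero hlen0
      have hle : H ≤ K := le_top
      refine le_trans ?_ (Finset.single_le_sum hnn (Finset.mem_range.2 (by omega : j < n)))
      refine le_trans ?_ (Finset.single_le_sum
        (fun q _ => by split_ifs <;> norm_num) (a := p.mapLe hle) ?_)
      · rw [if_pos]
        intro e he
        simp only [List.coe_toFinset, Set.mem_ofPred_eq, SimpleGraph.Walk.edges_mapLe_eq_edges]
          at he
        exact p.edges_subset_edgeSet he
      · rw [Finset.mem_filter, SimpleGraph.mem_finsetWalkLength_iff]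
        exact ⟨by simpa using hj, hp.mapLe hle⟩
    · exact Finset.sum_nonneg hnn
  have h2 : ∀ (j : ℕ) (p : K.Walk a b), p.IsPath →
      ∑ H, graphProb w H * (if (p.edges.toFinset : Set (Sym2 (Fin n))) ⊆ H.edgeSet then 1 else 0)
        ≤ (p.edges.map (edgeBound w)).prod := by
    intro j p hp
    rw [sum_graphProb_subset, ← List.prod_toFinset _ hp.edges_nodup]
    · exact Finset.prod_le_prod (fun e _ => edgeProb_nonneg hw e)
        fun e _ => edgeProb_le_edgeBound hw e
    · intro e he
      exact K.not_isDiag_of_mem_edgeSet (p.edges_subset_edgeSet (List.mem_toFinset.1 he))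
  calc ∑ H, graphProb w H * (if H.Reachable a b then 1 else 0)
      ≤ ∑ H, graphProb w H * ∑ j ∈ Finset.range n,
          ∑ p ∈ K.finsetWalkLength (j + 1) a b with p.IsPath,
            (if (p.edges.toFinset : Set (Sym2 (Fin n))) ⊆ H.edgeSet then 1 else 0) :=
        Finset.sum_le_sum fun H _ => mul_le_mul_of_nonneg_left (h1 H) (graphProb_nonneg hw H)
    _ = ∑ j ∈ Finset.range n, ∑ p ∈ K.finsetWalkLength (j + 1) a b with p.IsPath,
          ∑ H, graphProb w H *
            (if (p.edges.toFinset : Set (Sym2 (Fin n))) ⊆ H.edgeSet then 1 else 0) := by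
        simp only [Finset.mul_sum]
        rw [Finset.sum_comm]
        exact Finset.sum_congr rfl fun j _ => Finset.sum_comm
    _ ≤ ∑ j ∈ Finset.range n, ∑ p ∈ K.finsetWalkLength (j + 1) a b with p.IsPath,
          (p.edges.map (edgeBound w)).prod :=
        Finset.sum_le_sum fun j _ => Finset.sum_le_sum fun p hp =>
          h2 j p (Finset.mem_filter.1 hp).2
    _ ≤ ∑ j ∈ Finset.range n, w a * w b / (∑ l, w l) * R ^ j := by
        -- The restriction to paths has served its purpose and is dropped, so that the bound for
        -- walks applies.
        refine Finset.sum_le_sum fun j _ => le_trans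
          (Finset.sum_le_sum_of_subset_of_nonneg (Finset.filter_subset _ _) fun p _ _ => ?_)
          (sum_finsetWalkLength_le hw b j a)
        exact List.prod_nonneg (by
          intro x hx
          obtain ⟨e, -, rfl⟩ := List.mem_map.1 hx
          exact edgeBound_nonneg hw e)
    _ ≤ _ := by
        rw [← Finset.mul_sum, ← tsum_geometric_of_lt_one hR0 hR]
        gcongr
        exact (summable_geometric_of_lt_one hR0 hR).sum_le_tsum _ fun j _ => by positivity

/-! ### Cycles in the random graph -/

theorem fin_cyclic_induction {P : Fin (m + 3) → Prop} (i₀ : Fin (m + 3)) (h0 : P i₀)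
    (hs : ∀ i, P i → P (i + 1)) (i : Fin (m + 3)) : P i := by
  suffices h : ∀ j : Fin (m + 3), P (i₀ + j) by
    have := h (i - i₀)
    rwa [add_sub_cancel] at this
  intro j
  induction j using Fin.induction with
  | zero => simpa using h0
  | succ j ih =>
    rw [← Fin.coeSucc_eq_succ, ← add_assoc]
    exact hs _ ih

theorem fin_add_one_ne (i : Fin (m + 3)) : i + 1 ≠ i := by
  intro h
  simp at h

/-- This is where cycle length at least 3 enters: the two neighbours of a position on the cycle are
distinct. -/
theorem fin_add_one_add_one_ne (i : Fin (m + 3)) : i + 1 + 1 ≠ i := by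
  intro h
  rw [add_assoc] at h
  have : (1 + 1 : Fin (m + 3)) = 0 := by simpa using h
  rw [Fin.ext_iff, Fin.val_add, Fin.val_one, Fin.val_zero] at this
  rw [Nat.mod_eq_of_lt (by omega)] at this
  omega

/-- The edges of the cycle `α 0 – α 1 – ⋯ – α (m + 2) – α 0`. -/
def cycleEdges (α : Fin (m + 3) → Fin n) : Finset (Sym2 (Fin n)) :=
  Finset.univ.image fun i => s(α i, α (i + 1))

theorem mem_cycleEdges (α : Fin (m + 3) → Fin n) (i : Fin (m + 3)) :
    s(α i, α (i + 1)) ∈ cycleEdges α :=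
  Finset.mem_image_of_mem _ (Finset.mem_univ i)

theorem mk_mem_cycleEdges {α : Fin (m + 3) → Fin n} (hα : Function.Injective α)
    {i : Fin (m + 3)} {x : Fin n} (h : s(α i, x) ∈ cycleEdges α) :
    x = α (i + 1) ∨ x = α (i - 1) := by
  obtain ⟨j, -, hj⟩ := Finset.mem_image.1 h
  rcases Sym2.eq_iff.1 hj with ⟨h1, h2⟩ | ⟨h1, h2⟩
  · left
    rw [← h2, hα h1]
  · right
    rw [← h1, ← hα h2, add_sub_cancel_right]

theorem exists_eq_of_mem_cycleEdges {α : Fin (m + 3) → Fin n} {x y : Fin n}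
    (h : s(x, y) ∈ cycleEdges α) : (∃ i, α i = x) ∧ ∃ i, α i = y := by
  obtain ⟨j, -, hj⟩ := Finset.mem_image.1 h
  rcases Sym2.eq_iff.1 hj with ⟨h1, h2⟩ | ⟨h1, h2⟩
  · exact ⟨⟨j, h1⟩, ⟨j + 1, h2⟩⟩
  · exact ⟨⟨j + 1, h2⟩, ⟨j, h1⟩⟩

theorem not_isDiag_of_mem_cycleEdges {α : Fin (m + 3) → Fin n} (hα : Function.Injective α)
    {e : Sym2 (Fin n)} (he : e ∈ cycleEdges α) : ¬ e.IsDiag := by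
  obtain ⟨j, -, rfl⟩ := Finset.mem_image.1 he
  rw [Sym2.mk_isDiag_iff]
  exact fun h => fin_add_one_ne j (hα h).symm

theorem cycleEdge_injective {α : Fin (m + 3) → Fin n} (hα : Function.Injective α) :
    Function.Injective fun i => s(α i, α (i + 1)) := by
  intro i j h
  rcases Sym2.eq_iff.1 h with ⟨h1, -⟩ | ⟨h1, h2⟩
  · exact hα h1
  · have h1' := hα h1
    have h2' := hα h2
    rw [h1'] at h2'
    exact absurd h2' (fin_add_one_add_one_ne j)

theorem cycleEdges_subset_iff {α : Fin (m + 3) → Fin n} {H : SimpleGraph (Fin n)} :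
    (cycleEdges α : Set (Sym2 (Fin n))) ⊆ H.edgeSet ↔ ∀ i, H.Adj (α i) (α (i + 1)) := by
  simp [cycleEdges, Set.subset_def]

/-- Conditional probability that the cycle `α` is present. -/
def cycleProb (w : Fin n → ℝ) (α : Fin (m + 3) → Fin n) : ℝ :=
  ∏ i, connProb w (α i) (α (i + 1))

theorem prod_edgeProb_cycleEdges (w : Fin n → ℝ) {α : Fin (m + 3) → Fin n}
    (hα : Function.Injective α) : ∏ e ∈ cycleEdges α, edgeProb w e = cycleProb w α := by
  rw [cycleEdges, Finset.prod_image (cycleEdge_injective hα).injOn]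
  rfl

theorem cycleProb_nonneg {w : Fin n → ℝ} (hw : ∀ i, 0 < w i) (α : Fin (m + 3) → Fin n) :
    0 ≤ cycleProb w α :=
  Finset.prod_nonneg fun _ _ => connProb_nonneg hw _ _

/-- At a vertex of `α` lying on `β`, the two distinct `β`-neighbours must be the two `α`-neighbours;
hence the next vertex of `α` lies on `β` too, and this propagates around `α`. -/
theorem range_subset_of_cycleEdges_subset {α : Fin (m + 3) → Fin n} {β : Fin (l + 3) → Fin n}
    (hα : Function.Injective α) (hβ : Function.Injective β)
    (h : cycleEdges β ⊆ cycleEdges α) : Set.range α ⊆ Set.range β := by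
  obtain ⟨i₀, hi₀⟩ := (exists_eq_of_mem_cycleEdges (h (mem_cycleEdges β 0))).1
  rintro _ ⟨i, rfl⟩
  refine fin_cyclic_induction (P := fun i => α i ∈ Set.range β) i₀ ⟨0, hi₀.symm⟩ ?_ i
  rintro i ⟨t, ht⟩
  have h1 := h (mem_cycleEdges β t)
  have h2 := h (mem_cycleEdges β (t - 1))
  rw [sub_add_cancel, Sym2.eq_swap] at h2
  rw [ht] at h1 h2
  rcases mk_mem_cycleEdges hα h1 with h1 | h1
  · exact ⟨_, h1⟩
  rcases mk_mem_cycleEdges hα h2 with h2 | h2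
  · exact ⟨_, h2⟩
  have h3 := hβ (h1.trans h2.symm)
  have h4 := fin_add_one_add_one_ne (t - 1)
  rw [sub_add_cancel] at h4
  exact absurd h3 h4

/-- A cycle contains no other cycle. Equal vertex sets give equal lengths, the minimum fixes the
starting point, and the orientation condition fixes the second vertex. -/
theorem eq_of_cycleEdges_subset {α : Fin (m + 3) → Fin n} {β : Fin (l + 3) → Fin n}
    (hα : α ∈ possibleCycles n m) (hβ : β ∈ possibleCycles n l)
    (h : cycleEdges β ⊆ cycleEdges α) :
    (⟨l, β⟩ : Σ k : ℕ, Fin (k + 3) → Fin n) = ⟨m, α⟩ := by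
  obtain ⟨hα1, hα2, hα3⟩ := hα
  obtain ⟨hβ1, hβ2, hβ3⟩ := hβ
  have hr : Set.range α = Set.range β := by
    refine (range_subset_of_cycleEdges_subset hα1 hβ1 h).antisymm ?_
    rintro _ ⟨t, rfl⟩
    exact (exists_eq_of_mem_cycleEdges (h (mem_cycleEdges β t))).1
  have hml : m = l := by
    have h1 : (Set.range α).ncard = m + 3 := by
      rw [← Set.image_univ, Set.ncard_image_of_injective _ hα1, Set.ncard_univ, Nat.card_fin]
    have h2 : (Set.range β).ncard = l + 3 := by
      rw [← Set.image_univ, Set.ncard_image_of_injective _ hβ1, Set.ncard_univ, Nat.card_fin]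
    rw [hr] at h1
    omega
  subst hml
  have h0 : β 0 = α 0 := by
    obtain ⟨i, hi⟩ : β 0 ∈ Set.range α := hr ▸ Set.mem_range_self 0
    obtain ⟨t, ht⟩ : α 0 ∈ Set.range β := hr ▸ Set.mem_range_self 0
    exact le_antisymm (ht ▸ hβ2 t) (hi ▸ hα2 i)
  have hlast : (0 - 1 : Fin (m + 3)) = Fin.last (m + 2) := by
    rw [sub_eq_iff_eq_add, Fin.last_add_one]
  have h1 : β (0 + 1) = α (0 + 1) := by
    have e1 := h (mem_cycleEdges β 0)
    have e2 := h (mem_cycleEdges β (0 - 1))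
    rw [sub_add_cancel, Sym2.eq_swap] at e2
    rw [h0] at e1 e2
    rcases mk_mem_cycleEdges hα1 e1 with e1 | e1
    · exact e1
    rcases mk_mem_cycleEdges hα1 e2 with e2 | e2
    · rw [zero_add] at e1 e2
      rw [hlast] at e1 e2
      rw [e1, e2] at hβ3
      exact absurd hα3 hβ3.asymm
    · have h3 := hβ1 (e1.trans e2.symm)
      have h4 := fin_add_one_add_one_ne (0 - 1 : Fin (m + 3))
      rw [sub_add_cancel] at h4
      exact absurd h3 h4
  -- Two consecutive agreements force a third: the only alternative for the next vertex is to turn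
  -- back to `β t`.
  have key : ∀ t, β t = α t ∧ β (t + 1) = α (t + 1) := by
    refine fun t => fin_cyclic_induction (P := fun t => β t = α t ∧ β (t + 1) = α (t + 1)) 0
      ⟨h0, h1⟩ ?_ t
    rintro t ⟨e1, e2⟩
    refine ⟨e2, ?_⟩
    have e3 := h (mem_cycleEdges β (t + 1))
    rw [e2] at e3
    rcases mk_mem_cycleEdges hα1 e3 with e3 | e3
    · exact e3
    · rw [add_sub_cancel_right, ← e1] at e3
      exact absurd (hβ1 e3) (fin_add_one_add_one_ne t)
  have : β = α := funext fun t => (key t).1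
  rw [this]

/-- If a cycle `β` lives in the union of a graph `H` and a cycle `α` no two vertices of which are
connected in `H`, then `β` lives in `H` or in `α`. -/
theorem subset_or_subset_of_not_reachable {α : Fin (m + 3) → Fin n} {β : Fin (l + 3) → Fin n}
    {H : SimpleGraph (Fin n)} (hβ : Function.Injective β)
    (hreach : ∀ i j, H.Reachable (α i) (α j) → i = j)
    (h : ∀ t, H.Adj (β t) (β (t + 1)) ∨ s(β t, β (t + 1)) ∈ cycleEdges α) :
    (∀ t, H.Adj (β t) (β (t + 1))) ∨ cycleEdges β ⊆ cycleEdges α := by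
  by_contra! hcon
  obtain ⟨⟨t₀, ht₀⟩, h2⟩ := hcon
  have hP₀ := (h t₀).resolve_left ht₀
  -- Take a place where `β` leaves `α`. From there on `β` runs inside `H`; returning to an edge of
  -- `α` would connect the exit vertex in `H` to a vertex of `α`, hence to itself, so `β` never
  -- returns, against its cyclicity.
  have hex : ∃ i, s(β i, β (i + 1)) ∈ cycleEdges α ∧
      s(β (i + 1), β (i + 1 + 1)) ∉ cycleEdges α := by
    by_contra! hall
    refine h2 fun e he => ?_
    obtain ⟨t, -, rfl⟩ := Finset.mem_image.1 he
    exact fin_cyclic_induction (P := fun t => s(β t, β (t + 1)) ∈ cycleEdges α) t₀ hP₀ hall t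
  obtain ⟨i, hi1, hi2⟩ := hex
  obtain ⟨a, ha⟩ := (exists_eq_of_mem_cycleEdges hi1).2
  have key := fin_cyclic_induction (P := fun t => s(β t, β (t + 1)) ∉ cycleEdges α ∧
    H.Reachable (β (i + 1)) (β t)) (i + 1) ⟨hi2, SimpleGraph.Reachable.refl _⟩ (by
      rintro t ⟨h3, h4⟩
      have h5 : H.Reachable (β (i + 1)) (β (t + 1)) :=
        h4.trans ((h t).resolve_right h3).reachable
      refine ⟨fun h6 => ?_, h5⟩
      obtain ⟨b, hb⟩ := (exists_eq_of_mem_cycleEdges h6).1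
      have h7 : b = a := (hreach _ _ (by rwa [ha, hb])).symm
      have h8 : t + 1 = i + 1 := hβ (by rw [← hb, ← ha, h7])
      rw [h8] at h6
      exact hi2 h6)
  exact (key i).1 hi1

/-! ### Cycle counts and the insertion of one cycle -/

open Classical in
/-- The possible cycles whose length lies in `A`. -/
def cyclesIn (n : ℕ) (A : Set ℕ) : Finset (Σ k : ℕ, Fin (k + 3) → Fin n) :=
  ((Finset.range n).filter fun k => k + 3 ∈ A).sigma fun k =>
    Finset.univ.filter fun α => α ∈ possibleCycles n k

theorem mem_possibleCycles_of_mem_cyclesIn {A : Set ℕ} {c : Σ k : ℕ, Fin (k + 3) → Fin n}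
    (hc : c ∈ cyclesIn n A) : c.2 ∈ possibleCycles n c.1 := by
  classical
  simp only [cyclesIn, Finset.mem_sigma, Finset.mem_filter] at hc
  exact hc.2.2

open Classical in
/-- The number of cycles of `H` whose length lies in `A`. -/
def cycleCount (A : Set ℕ) (H : SimpleGraph (Fin n)) : ℕ :=
  ((cyclesIn n A).filter fun c => ∀ i, H.Adj (c.2 i) (c.2 (i + 1))).card

theorem cycleCount_sup {A : Set ℕ} {c : Σ k : ℕ, Fin (k + 3) → Fin n} (hc : c ∈ cyclesIn n A)
    {H : SimpleGraph (Fin n)} (hreach : ∀ i j, H.Reachable (c.2 i) (c.2 j) → i = j) :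
    cycleCount A (H ⊔ SimpleGraph.fromEdgeSet (cycleEdges c.2 : Set (Sym2 (Fin n)))) =
      cycleCount A H + 1 := by
  classical
  have hα := mem_possibleCycles_of_mem_cyclesIn hc
  have hadj : ∀ x y, (H ⊔ SimpleGraph.fromEdgeSet (cycleEdges c.2 : Set (Sym2 (Fin n)))).Adj x y ↔
      H.Adj x y ∨ s(x, y) ∈ cycleEdges c.2 := by
    intro x y
    rw [SimpleGraph.sup_adj, SimpleGraph.fromEdgeSet_adj, Finset.mem_coe]
    have : s(x, y) ∈ cycleEdges c.2 → x ≠ y := fun h => by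
      simpa using not_isDiag_of_mem_cycleEdges hα.1 h
    tauto
  unfold cycleCount
  rw [← Finset.card_insert_of_notMem (a := c)]
  · congr 1
    ext d
    simp only [Finset.mem_filter, Finset.mem_insert, hadj]
    constructor
    · rintro ⟨hd, h⟩
      have hβ := mem_possibleCycles_of_mem_cyclesIn hd
      rcases subset_or_subset_of_not_reachable hβ.1 hreach h with h | h
      · exact Or.inr ⟨hd, h⟩
      · exact Or.inl (eq_of_cycleEdges_subset hα hβ h)
    · rintro (rfl | ⟨hd, h⟩)
      · exact ⟨hc, fun i => Or.inr (mem_cycleEdges _ i)⟩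
      · exact ⟨hd, fun i => Or.inl (h i)⟩
  -- The inserted cycle is new: otherwise its own vertices would already be connected in `H`.
  · intro h
    exact fin_add_one_ne _ (hreach _ _ ((Finset.mem_filter.1 h).2 0).reachable).symm

/-! ### Poisson approximation given the weights -/

open Classical in
-- Size-bias identity: write the count as a sum of indicators and turn each indicator into the
-- insertion of the corresponding cycle.
theorem sum_graphProb_cycleCount_mul (w : Fin n → ℝ) (A : Set ℕ) (f : ℕ → ℝ) :
    ∑ H : SimpleGraph (Fin n), graphProb w H * (cycleCount A H * f (cycleCount A H)) =
      ∑ c ∈ cyclesIn n A, cycleProb w c.2 * ∑ H : SimpleGraph (Fin n), graphProb w H *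
        f (cycleCount A (H ⊔ SimpleGraph.fromEdgeSet (cycleEdges c.2 : Set (Sym2 (Fin n))))) := by
  have h1 : ∀ H : SimpleGraph (Fin n), graphProb w H * (cycleCount A H * f (cycleCount A H)) =
      ∑ c ∈ cyclesIn n A, graphProb w H *
        (if (cycleEdges c.2 : Set (Sym2 (Fin n))) ⊆ H.edgeSet then f (cycleCount A H) else 0) := by
    intro H
    rw [← Finset.mul_sum]
    congr 1
    simp only [cycleEdges_subset_iff]
    rw [← Finset.sum_filter, Finset.sum_const, nsmul_eq_mul]
    rfl
  simp only [h1]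
  rw [Finset.sum_comm]
  refine Finset.sum_congr rfl fun c hc => ?_
  have hα := mem_possibleCycles_of_mem_cyclesIn hc
  rw [sum_graphProb_mul_ite_subset w _ (fun e he => not_isDiag_of_mem_cycleEdges hα.1 he)
    (fun H => f (cycleCount A H)), prod_edgeProb_cycleEdges w hα.1]

/-- Conditional expectation of the number of cycles whose length lies in `A`. -/
def meanCycles (w : Fin n → ℝ) (A : Set ℕ) : ℝ :=
  ∑ c ∈ cyclesIn n A, cycleProb w c.2

/-- Stein's equation and the size-bias identity leave differences of `f` at `cycleCount A H + 1` and
at the count after insertion. These vanish unless two vertices of the cycle are connected in `H`;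
otherwise they are at most `4 exp Λ`. -/
theorem abs_sum_graphProb_sub_poissonExp_le {w : Fin n → ℝ} (hw : ∀ i, 0 < w i)
    (hR : (∑ l, w l ^ 2) / ∑ l, w l < 1) (A : Set ℕ) {g : ℕ → ℝ} (hg : ∀ k, |g k| ≤ 1) :
    |∑ H : SimpleGraph (Fin n), graphProb w H * g (cycleCount A H) -
        poissonExp g (meanCycles w A)| ≤
      4 * Real.exp (meanCycles w A) * (1 - (∑ l, w l ^ 2) / ∑ l, w l)⁻¹ *
        ∑ c ∈ cyclesIn n A, cycleProb w c.2 *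
          ∑ p ∈ Finset.univ.offDiag, w (c.2 p.1) * w (c.2 p.2) / ∑ l, w l := by
  classical
  set Λ := meanCycles w A with hΛ
  have hΛ0 : 0 ≤ Λ := Finset.sum_nonneg fun c _ => cycleProb_nonneg hw _
  obtain ⟨f, hf, hstein⟩ := exists_stein_solution hg hΛ0
  set G := fun c : Σ k : ℕ, Fin (k + 3) → Fin n =>
    SimpleGraph.fromEdgeSet (cycleEdges c.2 : Set (Sym2 (Fin n)))
  have e1 : ∑ H : SimpleGraph (Fin n), graphProb w H * g (cycleCount A H) - poissonExp g Λ =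
      ∑ c ∈ cyclesIn n A, cycleProb w c.2 * ∑ H : SimpleGraph (Fin n), graphProb w H *
        (f (cycleCount A H + 1) - f (cycleCount A (H ⊔ G c))) := by
    have e2 : ∑ H : SimpleGraph (Fin n), graphProb w H * g (cycleCount A H) - poissonExp g Λ =
        ∑ H : SimpleGraph (Fin n), graphProb w H * (Λ * f (cycleCount A H + 1)) -
        ∑ H : SimpleGraph (Fin n), graphProb w H * (cycleCount A H * f (cycleCount A H)) := by
      rw [← Finset.sum_sub_distrib]
      have : poissonExp g Λ = ∑ H : SimpleGraph (Fin n), graphProb w H * poissonExp g Λ := by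
        rw [← Finset.sum_mul, sum_graphProb, one_mul]
      rw [this, ← Finset.sum_sub_distrib]
      refine Finset.sum_congr rfl fun H _ => ?_
      rw [← mul_sub, ← mul_sub, hstein]
    rw [e2, sum_graphProb_cycleCount_mul]
    simp only [mul_sub, Finset.sum_sub_distrib]
    congr 1
    rw [← Finset.sum_mul, hΛ, meanCycles, Finset.mul_sum]
    refine Finset.sum_congr rfl fun H _ => ?_
    ring
  rw [e1]
  calc _ ≤ ∑ c ∈ cyclesIn n A, cycleProb w c.2 * (4 * Real.exp Λ *
        ∑ p ∈ Finset.univ.offDiag, w (c.2 p.1) * w (c.2 p.2) / (∑ l, w l) *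
          (1 - (∑ l, w l ^ 2) / ∑ l, w l)⁻¹) := by
        refine (Finset.abs_sum_le_sum_abs _ _).trans (Finset.sum_le_sum fun c hc => ?_)
        rw [abs_mul, abs_of_nonneg (cycleProb_nonneg hw _)]
        refine mul_le_mul_of_nonneg_left ?_ (cycleProb_nonneg hw _)
        have hα := mem_possibleCycles_of_mem_cyclesIn hc
        have h1 : ∀ H : SimpleGraph (Fin n),
            |f (cycleCount A H + 1) - f (cycleCount A (H ⊔ G c))| ≤
            4 * Real.exp Λ * ∑ p ∈ Finset.univ.offDiag,
              (if H.Reachable (c.2 p.1) (c.2 p.2) then (1 : ℝ) else 0) := by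
          intro H
          have hnn : ∀ p ∈ Finset.univ.offDiag,
              (0 : ℝ) ≤ if H.Reachable (c.2 p.1) (c.2 p.2) then (1 : ℝ) else 0 := fun p _ => by
            split_ifs <;> norm_num
          by_cases hreach : ∀ i j, H.Reachable (c.2 i) (c.2 j) → i = j
          · rw [cycleCount_sup hc hreach, sub_self, abs_zero]
            exact mul_nonneg (by positivity) (Finset.sum_nonneg hnn)
          · push Not at hreach
            obtain ⟨i, j, h2, h3⟩ := hreach
            have h4 := Finset.single_le_sum hnn (a := (i, j))
              (Finset.mem_offDiag.2 ⟨Finset.mem_univ i, Finset.mem_univ j, h3⟩)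
            simp only [if_pos h2] at h4
            calc _ ≤ |f (cycleCount A H + 1)| + |f (cycleCount A (H ⊔ G c))| := abs_sub _ _
              _ ≤ 2 * Real.exp Λ + 2 * Real.exp Λ := add_le_add (hf _) (hf _)
              _ = 4 * Real.exp Λ * 1 := by ring
              _ ≤ _ := by gcongr
        calc _ ≤ ∑ H, graphProb w H * (4 * Real.exp Λ * ∑ p ∈ Finset.univ.offDiag,
              (if H.Reachable (c.2 p.1) (c.2 p.2) then (1 : ℝ) else 0)) := by
              refine (Finset.abs_sum_le_sum_abs _ _).trans (Finset.sum_le_sum fun H _ => ?_)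
              rw [abs_mul, abs_of_nonneg (graphProb_nonneg hw H)]
              exact mul_le_mul_of_nonneg_left (h1 H) (graphProb_nonneg hw H)
          _ = 4 * Real.exp Λ * ∑ p ∈ Finset.univ.offDiag, ∑ H, graphProb w H *
              (if H.Reachable (c.2 p.1) (c.2 p.2) then (1 : ℝ) else 0) := by
              simp only [Finset.mul_sum]
              rw [Finset.sum_comm]
              refine Finset.sum_congr rfl fun p _ => Finset.sum_congr rfl fun H _ => ?_
              ring
          _ ≤ _ := by
              gcongr with p hp
              exact sum_graphProb_reachable_le hw hR
                (fun h => (Finset.mem_offDiag.1 hp).2.2 (hα.1 h))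
    _ = _ := by
        rw [Finset.mul_sum]
        refine Finset.sum_congr rfl fun c _ => ?_
        rw [← Finset.sum_mul]
        ring

/-! ### Sums over tuples of vertices -/

/-- Two coordinates interact through `g`. Fixing their values by indicators makes the summand a
product over coordinates, and the sum factorises. -/
theorem sum_tuples_mul_prod (x : Fin n → ℝ) (g : Fin n → Fin n → ℝ) {i j : Fin (m + 3)}
    (hij : i ≠ j) :
    ∑ α : Fin (m + 3) → Fin n, g (α i) (α j) * ∏ l, x (α l) =
      (∑ a, x a) ^ (m + 1) * ∑ a, ∑ b, g a b * (x a * x b) := by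
  classical
  set u : Fin n → Fin n → Fin (m + 3) → Fin n → ℝ := fun a b l v =>
    if l = i then (if v = a then x v else 0) else if l = j then (if v = b then x v else 0) else x v
    with hu
  have hji : j ∈ Finset.univ.erase i := Finset.mem_erase.2 ⟨hij.symm, Finset.mem_univ _⟩
  have hprod : ∀ f : Fin (m + 3) → ℝ,
      ∏ l, f l = f i * (f j * ∏ l ∈ (Finset.univ.erase i).erase j, f l) := fun f => by
    rw [Finset.mul_prod_erase _ _ hji, Finset.mul_prod_erase _ _ (Finset.mem_univ i)]
  have hrest : ∀ l ∈ (Finset.univ.erase i).erase j, l ≠ i ∧ l ≠ j := fun l hl => by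
    simp only [Finset.mem_erase] at hl
    exact ⟨hl.2.1, hl.1⟩
  have h1 : ∀ α : Fin (m + 3) → Fin n, g (α i) (α j) * ∏ l, x (α l) =
      ∑ a, ∑ b, g a b * ∏ l, u a b l (α l) := by
    intro α
    rw [Finset.sum_eq_single (α i), Finset.sum_eq_single (α j)]
    · congr 1
      refine Finset.prod_congr rfl fun l _ => ?_
      simp only [hu]
      split_ifs with h h2 h3 h4
      · rfl
      · exact absurd (by rw [h]) h2
      · rfl
      · exact absurd (by rw [h3]) h4
      · rfl
    · intro b _ hb
      rw [Finset.prod_eq_zero (Finset.mem_univ j), mul_zero]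
      simp [hu, hij.symm, hb.symm]
    · simp
    · intro a _ ha
      refine Finset.sum_eq_zero fun b _ => ?_
      rw [Finset.prod_eq_zero (Finset.mem_univ i), mul_zero]
      simp [hu, ha.symm]
    · simp
  have h2 : ∀ a b, ∑ α : Fin (m + 3) → Fin n, ∏ l, u a b l (α l) =
      x a * (x b * (∑ v, x v) ^ (m + 1)) := by
    intro a b
    rw [← Fintype.piFinset_univ, ← Finset.prod_univ_sum, hprod]
    congr 1
    · simp [hu]
    · congr 1
      · simp [hu, hij.symm]
      · rw [Finset.prod_congr rfl (g := fun _ => ∑ v, x v), Finset.prod_const]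
        · congr 1
          rw [Finset.card_erase_of_mem hji, Finset.card_erase_of_mem (Finset.mem_univ _)]
          simp
        · intro l hl
          obtain ⟨hli, hlj⟩ := hrest l hl
          simp [hu, hli, hlj]
  simp only [h1]
  rw [Finset.sum_comm, Finset.mul_sum]
  refine Finset.sum_congr rfl fun a _ => ?_
  rw [Finset.sum_comm, Finset.mul_sum]
  refine Finset.sum_congr rfl fun b _ => ?_
  rw [← Finset.mul_sum, h2]
  ring

theorem sum_tuples_prod (x : Fin n → ℝ) (k : ℕ) :
    ∑ α : Fin k → Fin n, ∏ l, x (α l) = (∑ a, x a) ^ k := by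
  classical
  rw [← Fintype.piFinset_univ, ← Finset.prod_univ_sum]
  simp

open Classical in
/-- A sum over injective tuples of a function invariant under the dihedral group is `2 k` times
the sum over the possible cycles. -/
theorem sum_injective_eq_mul_sum_possibleCycles (F : (Fin (m + 3) → Fin n) → ℝ)
    (hrot : ∀ α i, F (fun l => α (l + i)) = F α) (hrefl : ∀ α, F (fun l => α (-l)) = F α) :
    ∑ α with Function.Injective α, F α =
      2 * (m + 3) * ∑ α with α ∈ possibleCycles n m, F α := by
  have hlast : (-1 : Fin (m + 3)) = Fin.last (m + 2) := by
    rw [neg_eq_iff_add_eq_zero, add_comm (1 : Fin (m + 3)), Fin.last_add_one]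
  -- Sorting by the position of the smallest vertex yields the factor `m + 3`, after rotating it to
  -- position 0; the two orientations yield the factor 2.
  have h1 : ∑ α with Function.Injective α, F α =
      ∑ i, ∑ α, if Function.Injective α ∧ ∀ j, α i ≤ α j then F α else 0 := by
    rw [Finset.sum_comm, Finset.sum_filter]
    refine Finset.sum_congr rfl fun α _ => ?_
    split_ifs with h
    · obtain ⟨i, hi⟩ := Finite.exists_min α
      rw [Finset.sum_eq_single i]
      · rw [if_pos ⟨h, hi⟩]
      · intro j _ hj
        rw [if_neg]
        exact fun h' => hj (h (le_antisymm (h'.2 i) (hi j)))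
      · simp
    · simp [h]
  have h2 : ∀ i : Fin (m + 3),
      (∑ α : Fin (m + 3) → Fin n, if Function.Injective α ∧ ∀ j, α i ≤ α j then F α else 0) =
      ∑ α : Fin (m + 3) → Fin n, if Function.Injective α ∧ ∀ j, α 0 ≤ α j then F α else 0 := by
    intro i
    refine Fintype.sum_equiv ((Equiv.subRight i).arrowCongr (Equiv.refl (Fin n))) _ _ fun α => ?_
    have e : (Equiv.subRight i).arrowCongr (Equiv.refl (Fin n)) α = fun l => α (l + i) := by
      ext l
      simp [Equiv.arrowCongr]
    rw [e, hrot]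
    congr 1
    rw [eq_iff_iff]
    refine and_congr ?_ ?_
    · exact ((Equiv.addRight i).injective_comp α).symm
    · simp only [zero_add]
      exact ((Equiv.addRight i).forall_congr_right (q := fun j => α i ≤ α j)).symm
  have h3 : (∑ α : Fin (m + 3) → Fin n, if Function.Injective α ∧ ∀ j, α 0 ≤ α j then F α else 0) =
      (∑ α : Fin (m + 3) → Fin n, if α ∈ possibleCycles n m then F α else 0) +
      ∑ α : Fin (m + 3) → Fin n, if (fun l => α (-l)) ∈ possibleCycles n m then F α else 0 := by
    rw [← Finset.sum_add_distrib]
    refine Finset.sum_congr rfl fun α _ => ?_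
    have hinj : Function.Injective (fun l => α (-l)) ↔ Function.Injective α :=
      (Equiv.neg _).injective_comp α
    have hmin : (∀ l, α (-0) ≤ α (-l)) ↔ ∀ l, α 0 ≤ α l := by
      rw [neg_zero]
      exact (Equiv.neg (Fin (m + 3))).forall_congr_right (q := fun j => α 0 ≤ α j)
    have hl : -Fin.last (m + 2) = 1 := by rw [← hlast, neg_neg]
    simp only [possibleCycles, Set.mem_ofPred_eq, hinj, hmin, hlast, hl]
    by_cases h : Function.Injective α ∧ ∀ j, α 0 ≤ α j
    · have hne : α 1 ≠ α (Fin.last (m + 2)) := by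
        rw [← hlast]
        intro h'
        have h5 := h.1 h'
        have h6 := fin_add_one_add_one_ne (-1 : Fin (m + 3))
        rw [neg_add_cancel, zero_add] at h6
        exact h6 h5
      rcases lt_or_gt_of_ne hne with h' | h'
      · simp [h, h', h'.asymm]
      · simp [h, h', h'.asymm]
    · have h4 : ∀ p : Prop, ¬ (Function.Injective α ∧ (∀ j, α 0 ≤ α j) ∧ p) :=
        fun p h' => h ⟨h'.1, h'.2.1⟩
      simp [h, h4]
  have h4 : (∑ α : Fin (m + 3) → Fin n, if (fun l => α (-l)) ∈ possibleCycles n m then F α else 0) =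
      ∑ α : Fin (m + 3) → Fin n, if α ∈ possibleCycles n m then F α else 0 := by
    refine Fintype.sum_equiv ((Equiv.neg _).arrowCongr (Equiv.refl (Fin n))) _ _ fun α => ?_
    have e : (Equiv.neg (Fin (m + 3))).arrowCongr (Equiv.refl (Fin n)) α = fun l => α (-l) := by
      ext l
      simp [Equiv.arrowCongr]
    rw [e, hrefl]
  rw [h1, Finset.sum_congr rfl fun i _ => h2 i, Finset.sum_const, h3, h4, Finset.sum_filter]
  simp
  ring

theorem cycleProb_rotate (w : Fin n → ℝ) (α : Fin (m + 3) → Fin n) (i : Fin (m + 3)) :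
    cycleProb w (fun l => α (l + i)) = cycleProb w α := by
  unfold cycleProb
  refine Fintype.prod_equiv (Equiv.addRight i) _ _ fun l => ?_
  simp only [Equiv.coe_addRight, add_right_comm]

theorem cycleProb_reflect (w : Fin n → ℝ) (α : Fin (m + 3) → Fin n) :
    cycleProb w (fun l => α (-l)) = cycleProb w α := by
  unfold cycleProb
  refine Fintype.prod_equiv ((Equiv.addRight 1).trans (Equiv.neg _)) _ _ fun l => ?_
  simp only [Equiv.trans_apply, Equiv.coe_addRight, Equiv.neg_apply]
  rw [connProb_comm]
  congr 2
  rw [neg_add_rev, add_comm (-1 : Fin (m + 3)), neg_add_cancel_right]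

/-! ### Estimates for sums over cycles -/

/-- The sum `∑ w a ^ 3 * w b ^ 3` over pairs of distinct vertices. -/
def pairCubes (w : Fin n → ℝ) : ℝ := ∑ a, ∑ b, if a = b then 0 else w a ^ 3 * w b ^ 3

theorem pairCubes_nonneg {w : Fin n → ℝ} (hw : ∀ i, 0 < w i) : 0 ≤ pairCubes w :=
  Finset.sum_nonneg fun a _ => Finset.sum_nonneg fun b _ => by
    have := hw a
    have := hw b
    split_ifs <;> positivity

/-- Around a cycle every vertex is an endpoint of exactly two edges. -/
theorem prod_shift (w : Fin n → ℝ) (α : Fin (m + 3) → Fin n) (c : ℝ) :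
    ∏ i, (w (α i) * w (α (i + 1)) / c) = ∏ i, (w (α i) ^ 2 / c) := by
  simp only [Finset.prod_div_distrib, Finset.prod_mul_distrib, Finset.prod_pow]
  have : ∏ i, w (α (i + 1)) = ∏ i, w (α i) :=
    Fintype.prod_equiv (Equiv.addRight 1) _ _ fun l => rfl
  rw [this, sq]

theorem cycleProb_le {w : Fin n → ℝ} (hw : ∀ i, 0 < w i) (α : Fin (m + 3) → Fin n) :
    cycleProb w α ≤ ∏ i, (w (α i) ^ 2 / ∑ l, w l) := by
  rw [← prod_shift]
  exact Finset.prod_le_prod (fun _ _ => connProb_nonneg hw _ _) fun _ _ => connProb_le_div hw _ _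

theorem one_sub_sum_le_prod_inv {ι : Type*} (s : Finset ι) {y : ι → ℝ} (hy : ∀ i, 0 ≤ y i) :
    1 - ∑ i ∈ s, y i ≤ ∏ i ∈ s, (1 + y i)⁻¹ := by
  classical
  induction s using Finset.induction_on with
  | empty => simp
  | insert a s ha ih =>
    rw [Finset.sum_insert ha, Finset.prod_insert ha]
    have h0 : 0 ≤ ∏ i ∈ s, (1 + y i)⁻¹ := Finset.prod_nonneg fun i _ => by
      have := hy i
      positivity
    have h1 : ∏ i ∈ s, (1 + y i)⁻¹ ≤ 1 := Finset.prod_le_one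
      (fun i _ => by have := hy i; positivity)
      fun i _ => inv_le_one_of_one_le₀ (by linarith [hy i])
    have h2 : 1 - y a ≤ (1 + y a)⁻¹ := by
      have := hy a
      rw [← one_div, le_div_iff₀ (by positivity)]
      nlinarith
    nlinarith [mul_le_mul_of_nonneg_right h2 h0, hy a]

/-- With `y = w i * w j / L` the connection probability is `y * (1 + y)⁻¹`, so the loss is
controlled by `one_sub_sum_le_prod_inv`. -/
theorem prod_sub_cycleProb_le {w : Fin n → ℝ} (hw : ∀ i, 0 < w i) (α : Fin (m + 3) → Fin n) :
    ∏ i, (w (α i) ^ 2 / ∑ l, w l) - cycleProb w α ≤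
      ∑ i, w (α i) * w (α (i + 1)) / (∑ l, w l) * ∏ i, (w (α i) ^ 2 / ∑ l, w l) := by
  have hL := sum_weights_pos hw (α 0)
  set y : Fin (m + 3) → ℝ := fun i => w (α i) * w (α (i + 1)) / ∑ l, w l with hy
  have hy0 : ∀ i, 0 ≤ y i := fun i => by
    have := hw (α i)
    have := hw (α (i + 1))
    positivity
  have h1 : cycleProb w α = (∏ i, y i) * ∏ i, (1 + y i)⁻¹ := by
    rw [cycleProb, ← Finset.prod_mul_distrib]
    refine Finset.prod_congr rfl fun i _ => ?_
    have := hw (α i)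
    have := hw (α (i + 1))
    simp only [hy, connProb]
    field_simp
    ring
  rw [h1, ← prod_shift w α, ← Finset.sum_mul]
  change ∏ i, y i - _ ≤ (∑ i, y i) * ∏ i, y i
  have h2 := mul_le_mul_of_nonneg_left (one_sub_sum_le_prod_inv Finset.univ hy0)
    (Finset.prod_nonneg fun i (_ : i ∈ Finset.univ) => hy0 i)
  linarith

/-- The two marked vertices each carry a cube. Excluding coincidence avoids `w ^ 6`, whose moment
need not be finite. -/
theorem sum_tuples_distinct_mul {w : Fin n → ℝ} {i j : Fin (m + 3)} (hij : i ≠ j) :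
    ∑ α : Fin (m + 3) → Fin n,
      (if α i = α j then 0 else w (α i) * w (α j) / ∑ l, w l) * ∏ l, (w (α l) ^ 2 / ∑ l, w l) =
    ((∑ l, w l ^ 2) / ∑ l, w l) ^ (m + 1) * (pairCubes w / (∑ l, w l) ^ 3) := by
  rw [sum_tuples_mul_prod (fun a => w a ^ 2 / ∑ l, w l)
    (fun a b => if a = b then 0 else w a * w b / ∑ l, w l) hij, ← Finset.sum_div]
  congr 1
  simp only [pairCubes, Finset.sum_div]
  refine Finset.sum_congr rfl fun a _ => Finset.sum_congr rfl fun b _ => ?_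
  split_ifs
  · simp
  · rw [div_mul_div_comm, div_mul_div_comm]
    congr 1 <;> ring

theorem sum_tuples_eq_mul {w : Fin n → ℝ} {i j : Fin (m + 3)} (hij : i ≠ j) :
    ∑ α : Fin (m + 3) → Fin n,
      (if α i = α j then 1 else 0) * ∏ l, (w (α l) ^ 2 / ∑ l, w l) =
    ((∑ l, w l ^ 2) / ∑ l, w l) ^ (m + 1) * ((∑ l, w l ^ 4) / (∑ l, w l) ^ 2) := by
  rw [sum_tuples_mul_prod (fun a => w a ^ 2 / ∑ l, w l)
    (fun a b => if a = b then 1 else 0) hij, ← Finset.sum_div]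
  congr 1
  rw [Finset.sum_div]
  refine Finset.sum_congr rfl fun a _ => ?_
  simp
  ring

open Classical in
theorem sum_cycleProb_mul_pairs_le {w : Fin n → ℝ} (hw : ∀ i, 0 < w i) (m : ℕ) :
    ∑ α with α ∈ possibleCycles n m, cycleProb w α *
        ∑ p ∈ Finset.univ.offDiag, w (α p.1) * w (α p.2) / ∑ l, w l ≤
      (m + 3) ^ 2 * ((∑ l, w l ^ 2) / ∑ l, w l) ^ (m + 1) * (pairCubes w / (∑ l, w l) ^ 3) := by
  have hL : 0 ≤ ∑ l, w l := Finset.sum_nonneg fun l _ => (hw l).le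
  have hS : 0 ≤ ∑ l, w l ^ 2 := Finset.sum_nonneg fun l _ => sq_nonneg _
  have hT := pairCubes_nonneg hw
  have hnn : ∀ (α : Fin (m + 3) → Fin n) (i j : Fin (m + 3)),
      0 ≤ (if α i = α j then 0 else w (α i) * w (α j) / ∑ l, w l) *
        ∏ l, (w (α l) ^ 2 / ∑ l, w l) := fun α i j => by
    have := hw (α i)
    have := hw (α j)
    have : 0 ≤ ∏ l, (w (α l) ^ 2 / ∑ l, w l) := Finset.prod_nonneg fun l _ => by positivity
    split_ifs <;> positivity
  calc _ ≤ ∑ α with α ∈ possibleCycles n m, ∑ p ∈ Finset.univ.offDiag,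
        (if α p.1 = α p.2 then 0 else w (α p.1) * w (α p.2) / ∑ l, w l) *
          ∏ l, (w (α l) ^ 2 / ∑ l, w l) := by
        refine Finset.sum_le_sum fun α hα => ?_
        rw [Finset.mul_sum]
        refine Finset.sum_le_sum fun p hp => ?_
        have hinj : Function.Injective α := (Finset.mem_filter.1 hα).2.1
        rw [if_neg fun h => (Finset.mem_offDiag.1 hp).2.2 (hinj h), mul_comm]
        have := hw (α p.1)
        have := hw (α p.2)
        exact mul_le_mul_of_nonneg_left (cycleProb_le hw α) (by positivity)
    _ ≤ ∑ α : Fin (m + 3) → Fin n, ∑ p ∈ Finset.univ.offDiag,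
        (if α p.1 = α p.2 then 0 else w (α p.1) * w (α p.2) / ∑ l, w l) *
          ∏ l, (w (α l) ^ 2 / ∑ l, w l) :=
        Finset.sum_le_sum_of_subset_of_nonneg (Finset.filter_subset _ _)
          fun α _ _ => Finset.sum_nonneg fun p _ => hnn α _ _
    _ = ∑ p ∈ (Finset.univ : Finset (Fin (m + 3))).offDiag,
        ((∑ l, w l ^ 2) / ∑ l, w l) ^ (m + 1) * (pairCubes w / (∑ l, w l) ^ 3) := by
        rw [Finset.sum_comm]
        exact Finset.sum_congr rfl fun p hp =>
          sum_tuples_distinct_mul (Finset.mem_offDiag.1 hp).2.2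
    _ ≤ _ := by
        rw [Finset.sum_const, nsmul_eq_mul, mul_assoc]
        refine mul_le_mul_of_nonneg_right ?_ (by positivity)
        rw [Finset.offDiag_card, Finset.card_univ, Fintype.card_fin, sq]
        exact_mod_cast Nat.sub_le _ _

open Classical in
-- All tuples together contribute exactly `R ^ (m + 3)`. The deficit comes from `connProb` being
-- smaller than `w i * w j / L` (the `pairCubes` term) and from tuples with a repeated vertex (the
-- fourth-power term).
theorem abs_sum_injective_cycleProb_sub_le {w : Fin n → ℝ} (hw : ∀ i, 0 < w i) (m : ℕ) :
    |∑ α : Fin (m + 3) → Fin n with Function.Injective α, cycleProb w α -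
        ((∑ l, w l ^ 2) / ∑ l, w l) ^ (m + 3)| ≤
      (m + 3) ^ 2 * ((∑ l, w l ^ 2) / ∑ l, w l) ^ (m + 1) *
        (pairCubes w / (∑ l, w l) ^ 3 + (∑ l, w l ^ 4) / (∑ l, w l) ^ 2) := by
  have hL : 0 ≤ ∑ l, w l := Finset.sum_nonneg fun l _ => (hw l).le
  have hS : 0 ≤ ∑ l, w l ^ 2 := Finset.sum_nonneg fun l _ => sq_nonneg _
  have hQ : 0 ≤ ∑ l, w l ^ 4 := Finset.sum_nonneg fun l _ => by positivity
  have hT := pairCubes_nonneg hw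
  set R := (∑ l, w l ^ 2) / ∑ l, w l with hR
  set x : (Fin (m + 3) → Fin n) → ℝ := fun α => ∏ l, (w (α l) ^ 2 / ∑ l, w l) with hx
  have hx0 : ∀ α, 0 ≤ x α := fun α => Finset.prod_nonneg fun l _ => by positivity
  have hR3 : R ^ (m + 3) = ∑ α, x α := by
    rw [hx, sum_tuples_prod (fun a => w a ^ 2 / ∑ l, w l), ← Finset.sum_div]
  have hupper : ∑ α : Fin (m + 3) → Fin n with Function.Injective α, cycleProb w α ≤
      R ^ (m + 3) := by
    rw [hR3]
    refine (Finset.sum_le_sum fun α _ => cycleProb_le hw α).trans ?_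
    exact Finset.sum_le_sum_of_subset_of_nonneg (Finset.filter_subset _ _) fun α _ _ => hx0 α
  rw [abs_of_nonpos (sub_nonpos.2 hupper), neg_sub]
  have hnn : ∀ (α : Fin (m + 3) → Fin n) (i j : Fin (m + 3)),
      0 ≤ (if α i = α j then 0 else w (α i) * w (α j) / ∑ l, w l) * x α := fun α i j => by
    have := hw (α i)
    have := hw (α j)
    have := hx0 α
    split_ifs <;> positivity
  have hnn' : ∀ (α : Fin (m + 3) → Fin n) (i j : Fin (m + 3)),
      0 ≤ (if α i = α j then (1 : ℝ) else 0) * x α := fun α i j => by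
    have := hx0 α
    split_ifs <;> positivity
  have hpt : ∀ α : Fin (m + 3) → Fin n,
      x α - (if Function.Injective α then cycleProb w α else 0) ≤
      ∑ i, (if α i = α (i + 1) then 0 else w (α i) * w (α (i + 1)) / ∑ l, w l) * x α +
      ∑ p ∈ Finset.univ.offDiag, (if α p.1 = α p.2 then 1 else 0) * x α := by
    intro α
    have h1 : 0 ≤ ∑ i, (if α i = α (i + 1) then 0 else w (α i) * w (α (i + 1)) / ∑ l, w l) * x α :=
      Finset.sum_nonneg fun i _ => hnn α _ _
    have h2 : 0 ≤ ∑ p ∈ Finset.univ.offDiag, (if α p.1 = α p.2 then (1 : ℝ) else 0) * x α :=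
      Finset.sum_nonneg fun p _ => hnn' α _ _
    split_ifs with hinj
    · refine le_trans (prod_sub_cycleProb_le hw α) ((le_of_eq ?_).trans (le_add_of_nonneg_right h2))
      refine Finset.sum_congr rfl fun i _ => ?_
      rw [if_neg fun h => fin_add_one_ne i (hinj h).symm]
    · obtain ⟨i, j, hij, hne⟩ : ∃ i j, α i = α j ∧ i ≠ j := by
        simpa [Function.Injective] using hinj
      have h3 := Finset.single_le_sum (fun p _ => hnn' α p.1 p.2) (a := (i, j))
        (Finset.mem_offDiag.2 ⟨Finset.mem_univ i, Finset.mem_univ j, hne⟩)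
      simp only [if_pos hij, one_mul] at h3
      linarith
  calc _ = ∑ α, (x α - (if Function.Injective α then cycleProb w α else 0)) := by
        rw [hR3, Finset.sum_sub_distrib, Finset.sum_filter]
    _ ≤ ∑ α, (∑ i, (if α i = α (i + 1) then 0 else w (α i) * w (α (i + 1)) / ∑ l, w l) * x α +
      ∑ p ∈ Finset.univ.offDiag, (if α p.1 = α p.2 then 1 else 0) * x α) :=
        Finset.sum_le_sum fun α _ => hpt α
    _ = ∑ i : Fin (m + 3), R ^ (m + 1) * (pairCubes w / (∑ l, w l) ^ 3) +
        ∑ p ∈ (Finset.univ : Finset (Fin (m + 3))).offDiag,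
          R ^ (m + 1) * ((∑ l, w l ^ 4) / (∑ l, w l) ^ 2) := by
        rw [Finset.sum_add_distrib, Finset.sum_comm, Finset.sum_comm (t := Finset.offDiag _)]
        congr 1
        · exact Finset.sum_congr rfl fun i _ =>
            sum_tuples_distinct_mul (fin_add_one_ne i).symm
        · exact Finset.sum_congr rfl fun p hp =>
            sum_tuples_eq_mul (Finset.mem_offDiag.1 hp).2.2
    _ ≤ (m + 3) ^ 2 * (R ^ (m + 1) * (pairCubes w / (∑ l, w l) ^ 3)) +
        (m + 3) ^ 2 * (R ^ (m + 1) * ((∑ l, w l ^ 4) / (∑ l, w l) ^ 2)) := by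
        rw [Finset.sum_const, Finset.sum_const, nsmul_eq_mul, nsmul_eq_mul, Finset.offDiag_card,
          Finset.card_univ, Fintype.card_fin]
        have hm : (0 : ℝ) ≤ m := Nat.cast_nonneg m
        refine add_le_add (mul_le_mul_of_nonneg_right ?_ (by positivity))
          (mul_le_mul_of_nonneg_right ?_ (by positivity))
        · push_cast
          nlinarith
        · rw [sq]
          exact_mod_cast Nat.sub_le _ _
    _ = _ := by ring

/-! ### Comparison given the weights -/

/-- The power series `∑ x ^ k / (2 k)` over the cycle lengths `k ∈ A`. -/
def limitMean (A : Set ℕ) (x : ℝ) : ℝ :=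
  ∑' k : ℕ, A.indicator (fun k : ℕ => 1 / (2 * (k : ℝ))) k * x ^ k

theorem abs_indicator_coeff_le (A : Set ℕ) (k : ℕ) :
    |A.indicator (fun k : ℕ => 1 / (2 * (k : ℝ))) k| ≤ 1 := by
  by_cases h : k ∈ A
  · rw [Set.indicator_of_mem h, abs_of_nonneg (by positivity)]
    rcases k with _ | k
    · simp
    · rw [div_le_one (by positivity)]
      push_cast
      linarith [(Nat.cast_nonneg k : (0 : ℝ) ≤ k)]
  · rw [Set.indicator_of_notMem h]
    simp

theorem indicator_coeff_nonneg (A : Set ℕ) (k : ℕ) :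
    0 ≤ A.indicator (fun k : ℕ => 1 / (2 * (k : ℝ))) k :=
  Set.indicator_nonneg (fun k _ => by positivity) k

theorem summable_limitMean (A : Set ℕ) {x : ℝ} (h0 : 0 ≤ x) (h1 : x < 1) :
    Summable fun k : ℕ => A.indicator (fun k : ℕ => 1 / (2 * (k : ℝ))) k * x ^ k := by
  refine Summable.of_norm_bounded (summable_geometric_of_lt_one h0 h1) fun k => ?_
  rw [Real.norm_eq_abs, abs_mul, abs_of_nonneg (pow_nonneg h0 k)]
  exact mul_le_of_le_one_left (pow_nonneg h0 k) (abs_indicator_coeff_le A k)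

theorem hasSum_limitMean {A : Set ℕ} (hA : A ⊆ Set.Ici 3) {x : ℝ} (h0 : 0 ≤ x) (h1 : x < 1) :
    HasSum (fun k : ℕ => A.indicator (fun k : ℕ => 1 / (2 * (k : ℝ))) (k + 3) * x ^ (k + 3))
      (limitMean A x) := by
  have h := (summable_limitMean A h0 h1).hasSum
  have hz : ∑ k ∈ Finset.range 3, A.indicator (fun k : ℕ => 1 / (2 * (k : ℝ))) k * x ^ k = 0 := by
    refine Finset.sum_eq_zero fun k hk => ?_
    rw [Set.indicator_of_notMem, zero_mul]
    intro h
    have h1 := hA h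
    have h2 := Finset.mem_range.1 hk
    simp only [Set.mem_Ici] at h1
    omega
  have h3 := (hasSum_nat_add_iff' 3).2 h
  rw [hz, sub_zero] at h3
  exact h3

theorem summable_cycle_bound {M : ℝ} (h0 : 0 < M) (h1 : M < 1) :
    Summable fun k : ℕ => ((k : ℝ) + 3) ^ 2 * M ^ (k + 1) := by
  have h := ((summable_nat_add_iff 2).2 (summable_sq_mul_geometric h0 h1)).mul_left M⁻¹
  refine h.congr fun k => ?_
  push_cast
  rw [pow_succ M (k + 1), show (k : ℝ) + 2 + 1 = k + 3 by ring]
  field_simp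

open Classical in
theorem sum_cyclesIn {β : Type*} [AddCommMonoid β] (A : Set ℕ)
    (F : (k : ℕ) → (Fin (k + 3) → Fin n) → β) :
    ∑ c ∈ cyclesIn n A, F c.1 c.2 =
      ∑ k ∈ (Finset.range n).filter fun k => k + 3 ∈ A,
        ∑ α with α ∈ possibleCycles n k, F k α := by
  rw [cyclesIn, Finset.sum_sigma]

open Classical in
theorem meanCycles_eq (w : Fin n → ℝ) (A : Set ℕ) :
    HasSum (fun k : ℕ => A.indicator (fun k : ℕ => 1 / (2 * (k : ℝ))) (k + 3) *
      ∑ α : Fin (k + 3) → Fin n with Function.Injective α, cycleProb w α) (meanCycles w A) := by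
  have h1 : meanCycles w A = ∑ k ∈ Finset.range n,
      A.indicator (fun k : ℕ => 1 / (2 * (k : ℝ))) (k + 3) *
        ∑ α : Fin (k + 3) → Fin n with Function.Injective α, cycleProb w α := by
    rw [meanCycles, sum_cyclesIn A fun k α => cycleProb w α, Finset.sum_filter]
    refine Finset.sum_congr rfl fun k _ => ?_
    split_ifs with h
    · rw [Set.indicator_of_mem h, sum_injective_eq_mul_sum_possibleCycles _
        (fun α i => cycleProb_rotate w α i) fun α => cycleProb_reflect w α]
      push_cast
      field_simp
    · rw [Set.indicator_of_notMem h, zero_mul]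
  rw [h1]
  refine hasSum_sum_of_ne_finset_zero fun k hk => ?_
  rw [Finset.sum_eq_zero, mul_zero]
  intro α hα
  have := Fintype.card_le_of_injective α (Finset.mem_filter.1 hα).2
  simp only [Fintype.card_fin] at this
  rw [Finset.mem_range] at hk
  omega

theorem abs_meanCycles_sub_le {M : ℝ} (hM0 : 0 < M) (hM1 : M < 1) {A : Set ℕ}
    (hA : A ⊆ Set.Ici 3) {w : Fin n → ℝ} (hw : ∀ i, 0 < w i)
    (hR : (∑ l, w l ^ 2) / ∑ l, w l ≤ M) :
    |meanCycles w A - limitMean A ((∑ l, w l ^ 2) / ∑ l, w l)| ≤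
      (∑' k : ℕ, ((k : ℝ) + 3) ^ 2 * M ^ (k + 1)) *
        (pairCubes w / (∑ l, w l) ^ 3 + (∑ l, w l ^ 4) / (∑ l, w l) ^ 2) := by
  classical
  have hL : 0 ≤ ∑ l, w l := Finset.sum_nonneg fun l _ => (hw l).le
  have hS : 0 ≤ ∑ l, w l ^ 2 := Finset.sum_nonneg fun l _ => sq_nonneg _
  have hQ : 0 ≤ ∑ l, w l ^ 4 := Finset.sum_nonneg fun l _ => by positivity
  have hT := pairCubes_nonneg hw
  have hR0 : 0 ≤ (∑ l, w l ^ 2) / ∑ l, w l := by positivity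
  have h := (meanCycles_eq w A).sub (hasSum_limitMean hA hR0 (hR.trans_lt hM1))
  rw [← h.tsum_eq, ← Real.norm_eq_abs]
  refine tsum_of_norm_bounded ((summable_cycle_bound hM0 hM1).hasSum.mul_right _) fun k => ?_
  rw [← mul_sub, Real.norm_eq_abs, abs_mul]
  calc _ ≤ 1 * _ := mul_le_mul_of_nonneg_right (abs_indicator_coeff_le A _) (abs_nonneg _)
    _ ≤ _ := by
      rw [one_mul]
      refine (abs_sum_injective_cycleProb_sub_le hw k).trans ?_
      gcongr

theorem sum_cyclesIn_pairs_le {M : ℝ} (hM0 : 0 < M) (hM1 : M < 1) (A : Set ℕ)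
    {w : Fin n → ℝ} (hw : ∀ i, 0 < w i) (hR : (∑ l, w l ^ 2) / ∑ l, w l ≤ M) :
    ∑ c ∈ cyclesIn n A, cycleProb w c.2 *
        ∑ p ∈ Finset.univ.offDiag, w (c.2 p.1) * w (c.2 p.2) / ∑ l, w l ≤
      (∑' k : ℕ, ((k : ℝ) + 3) ^ 2 * M ^ (k + 1)) * (pairCubes w / (∑ l, w l) ^ 3) := by
  classical
  have hL : 0 ≤ ∑ l, w l := Finset.sum_nonneg fun l _ => (hw l).le
  have hT := pairCubes_nonneg hw
  have hS : 0 ≤ ∑ l, w l ^ 2 := Finset.sum_nonneg fun l _ => sq_nonneg _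
  rw [sum_cyclesIn A fun k α => cycleProb w α *
        ∑ p ∈ Finset.univ.offDiag, w (α p.1) * w (α p.2) / ∑ l, w l, ← tsum_mul_right]
  refine le_trans (Finset.sum_le_sum fun k _ => (sum_cycleProb_mul_pairs_le hw k).trans ?_)
    (((summable_cycle_bound hM0 hM1).mul_right _).sum_le_tsum _ fun k _ => by positivity)
  gcongr

/-- A deliberately crude bound, reusing the series of the error estimates; it keeps the exponential
factor in the Stein bound under control. -/
theorem meanCycles_le {M : ℝ} (hM0 : 0 < M) (hM1 : M < 1) (A : Set ℕ)
    {w : Fin n → ℝ} (hw : ∀ i, 0 < w i) (hR : (∑ l, w l ^ 2) / ∑ l, w l ≤ M) :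
    meanCycles w A ≤ ∑' k : ℕ, ((k : ℝ) + 3) ^ 2 * M ^ (k + 1) := by
  classical
  have hL : 0 ≤ ∑ l, w l := Finset.sum_nonneg fun l _ => (hw l).le
  have hS : 0 ≤ ∑ l, w l ^ 2 := Finset.sum_nonneg fun l _ => sq_nonneg _
  rw [meanCycles, sum_cyclesIn A fun k α => cycleProb w α]
  refine le_trans (Finset.sum_le_sum fun k _ => ?_)
    ((summable_cycle_bound hM0 hM1).sum_le_tsum _ fun k _ => by positivity)
  calc ∑ α with α ∈ possibleCycles n k, cycleProb w α
      ≤ ∑ α with α ∈ possibleCycles n k, ∏ i, (w (α i) ^ 2 / ∑ l, w l) :=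
        Finset.sum_le_sum fun α _ => cycleProb_le hw α
    _ ≤ ∑ α : Fin (k + 3) → Fin n, ∏ i, (w (α i) ^ 2 / ∑ l, w l) :=
        Finset.sum_le_sum_of_subset_of_nonneg (Finset.filter_subset _ _)
          fun α _ _ => Finset.prod_nonneg fun i _ => by positivity
    _ = ((∑ l, w l ^ 2) / ∑ l, w l) ^ (k + 3) := by
        rw [sum_tuples_prod (fun a => w a ^ 2 / ∑ l, w l), ← Finset.sum_div]
    _ ≤ M ^ (k + 3) := by gcongr
    _ ≤ M ^ (k + 1) := pow_le_pow_of_le_one hM0.le hM1.le (by omega)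
    _ ≤ _ := by
        refine le_mul_of_one_le_left (by positivity) ?_
        nlinarith [(Nat.cast_nonneg k : (0 : ℝ) ≤ k)]

theorem abs_sum_graphProb_le_one {w : Fin n → ℝ} (hw : ∀ i, 0 < w i) (A : Set ℕ) {g : ℕ → ℝ}
    (hg : ∀ k, |g k| ≤ 1) :
    |∑ H : SimpleGraph (Fin n), graphProb w H * g (cycleCount A H)| ≤ 1 := by
  rw [← sum_graphProb w]
  refine (Finset.abs_sum_le_sum_abs _ _).trans (Finset.sum_le_sum fun H _ => ?_)
  rw [abs_mul, abs_of_nonneg (graphProb_nonneg hw H)]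
  exact mul_le_of_le_one_right (graphProb_nonneg hw H) (hg _)

/-- If the ratio `R = ∑ w² / ∑ w` is at most `M < 1`, the conditional expectation of a function
of the number of cycles is close to the Poisson expectation with the mean corresponding
to `R`. -/
theorem exists_abs_sum_graphProb_sub_le {M : ℝ} (hM0 : 0 < M) (hM1 : M < 1) :
    ∃ K, 0 ≤ K ∧ ∀ (n : ℕ) (A : Set ℕ), A ⊆ Set.Ici 3 → ∀ g : ℕ → ℝ, (∀ k, |g k| ≤ 1) →
      ∀ w : Fin n → ℝ, (∀ i, 0 < w i) → (∑ l, w l ^ 2) / ∑ l, w l ≤ M →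
      |∑ H : SimpleGraph (Fin n), graphProb w H * g (cycleCount A H) -
        poissonExp g (limitMean A ((∑ l, w l ^ 2) / ∑ l, w l))| ≤
      K * (pairCubes w / (∑ l, w l) ^ 3 + (∑ l, w l ^ 4) / (∑ l, w l) ^ 2) := by
  set S := ∑' k : ℕ, ((k : ℝ) + 3) ^ 2 * M ^ (k + 1) with hS
  have hS0 : 0 ≤ S := tsum_nonneg fun k => by positivity
  obtain ⟨K₁, hK₁⟩ := exists_taylorBound_of_coeff_le_one hM0 hM1
  have hN : 0 < max S K₁ + 1 := by positivity
  obtain ⟨K₂, hK₂⟩ := exists_taylorBound_poissonExp hN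
  -- The interval `[0, N]` contains both the conditional mean, at most `S`, and `limitMean`, at most
  -- `K₁`.
  set N := max S K₁ + 1 with hNdef
  have hK₂0 : 0 ≤ K₂ := by
    obtain ⟨g', h⟩ := hK₂ (fun _ => 0) (by simp)
    exact (abs_nonneg _).trans (h 0 ⟨le_rfl, hN.le⟩ 0 ⟨le_rfl, hN.le⟩).1
  refine ⟨4 * Real.exp S * (1 - M)⁻¹ * S + K₂ * (1 + N) * S, ?_, ?_⟩
  · have : 0 < 1 - M := by linarith
    positivity
  intro n A hA g hg w hw hR
  have hL : 0 ≤ ∑ l, w l := Finset.sum_nonneg fun l _ => (hw l).le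
  have hS2 : 0 ≤ ∑ l, w l ^ 2 := Finset.sum_nonneg fun l _ => sq_nonneg _
  have hQ : 0 ≤ ∑ l, w l ^ 4 := Finset.sum_nonneg fun l _ => by positivity
  have hT := pairCubes_nonneg hw
  set R := (∑ l, w l ^ 2) / ∑ l, w l with hRdef
  have hR0 : 0 ≤ R := by positivity
  have hΛ0 : 0 ≤ meanCycles w A := Finset.sum_nonneg fun c _ => cycleProb_nonneg hw _
  have hΛS := meanCycles_le hM0 hM1 A hw hR
  have h1 := abs_sum_graphProb_sub_poissonExp_le hw (hR.trans_lt hM1) A hg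
  have h2 := sum_cyclesIn_pairs_le hM0 hM1 A hw hR
  have h3 := abs_meanCycles_sub_le hM0 hM1 hA hw hR
  obtain ⟨φ', hφ⟩ := hK₁ _ (abs_indicator_coeff_le A)
  obtain ⟨g', hg'⟩ := hK₂ g hg
  have hφR : limitMean A R ∈ Set.Icc 0 N := by
    refine ⟨tsum_nonneg fun k => mul_nonneg (indicator_coeff_nonneg A k) (pow_nonneg hR0 k), ?_⟩
    have := (le_abs_self _).trans (hφ R ⟨hR0, hR⟩ R ⟨hR0, hR⟩).1
    exact this.trans ((le_max_right S K₁).trans (by linarith))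
  have hΛN : meanCycles w A ∈ Set.Icc 0 N :=
    ⟨hΛ0, hΛS.trans ((le_max_left S K₁).trans (by linarith))⟩
  have h4 := hg'.abs_sub_le hΛN hφR
  have hM' : 0 < 1 - M := by linarith
  set E := pairCubes w / (∑ l, w l) ^ 3 + (∑ l, w l ^ 4) / (∑ l, w l) ^ 2 with hE
  have hTE : pairCubes w / (∑ l, w l) ^ 3 ≤ E := le_add_of_nonneg_right (by positivity)
  have hE0 : 0 ≤ E := by positivity
  calc _ ≤ |∑ H : SimpleGraph (Fin n), graphProb w H * g (cycleCount A H) -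
          poissonExp g (meanCycles w A)| +
        |poissonExp g (meanCycles w A) - poissonExp g (limitMean A R)| := abs_sub_le _ _ _
    _ ≤ 4 * Real.exp S * (1 - M)⁻¹ * (S * E) + K₂ * (1 + N) * (S * E) := by
        refine add_le_add (h1.trans ?_) (h4.trans ?_)
        · have hnn : 0 ≤ ∑ c ∈ cyclesIn n A, cycleProb w c.2 *
              ∑ p ∈ Finset.univ.offDiag, w (c.2 p.1) * w (c.2 p.2) / ∑ l, w l :=
            Finset.sum_nonneg fun c _ => mul_nonneg (cycleProb_nonneg hw _)
              (Finset.sum_nonneg fun p _ => by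
                have := hw (c.2 p.1)
                have := hw (c.2 p.2)
                positivity)
          have hinv : (1 - R)⁻¹ ≤ (1 - M)⁻¹ := by gcongr
          refine mul_le_mul (mul_le_mul_of_nonneg_left hinv (by positivity) |>.trans ?_)
            (h2.trans (by gcongr)) hnn (by positivity)
          gcongr
        · have hK : 0 ≤ K₂ * (1 + N) := by positivity
          exact mul_le_mul_of_nonneg_left h3 hK
    _ = _ := by ring

theorem exists_taylorBound_poissonExp_limitMean {M : ℝ} (hM0 : 0 < M) (hM1 : M < 1) :
    ∃ K, 0 ≤ K ∧ ∀ (A : Set ℕ) (g : ℕ → ℝ), (∀ k, |g k| ≤ 1) →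
      ∃ f', TaylorBound K M (fun x => poissonExp g (limitMean A x)) f' := by
  obtain ⟨K₁, hK₁⟩ := exists_taylorBound_of_coeff_le_one hM0 hM1
  have hN : 0 < max 0 K₁ + 1 := by positivity
  obtain ⟨K₂, hK₂⟩ := exists_taylorBound_poissonExp hN
  have hex : ∀ (A : Set ℕ) (g : ℕ → ℝ), (∀ k, |g k| ≤ 1) →
      ∃ f', TaylorBound (K₂ * (1 + K₁ + (K₁ * (1 + M)) ^ 2)) M
        (fun x => poissonExp g (limitMean A x)) f' := by
    intro A g hg
    obtain ⟨φ', hφ⟩ := hK₁ _ (abs_indicator_coeff_le A)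
    obtain ⟨g', hg'⟩ := hK₂ g hg
    refine ⟨_, hg'.comp hφ fun x hx => ⟨?_, ?_⟩⟩
    · exact tsum_nonneg fun k => mul_nonneg (indicator_coeff_nonneg A k) (pow_nonneg hx.1 k)
    · have := (le_abs_self _).trans (hφ x hx x hx).1
      exact this.trans ((le_max_right 0 K₁).trans (by linarith))
  refine ⟨_, ?_, hex⟩
  obtain ⟨f', h⟩ := hex ∅ (fun _ => 0) (by simp)
  exact (abs_nonneg _).trans (h 0 ⟨le_rfl, hM0.le⟩ 0 ⟨le_rfl, hM0.le⟩).1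

/-- The error term in the conditional comparison. -/
def weightError (m₁ m₂ : ℝ) (w : Fin n → ℝ) : ℝ :=
  pairCubes w / n ^ 3 + (∑ l, w l ^ 4) / n ^ 2 +
    ((∑ l, w l - n * m₁) ^ 2 + (∑ l, w l ^ 2 - n * m₂) ^ 2) / n ^ 2

set_option maxHeartbeats 1000000 in
/-- Conditional comparison up to a multiple of the centred variable
`∑ w² - (m₂ / m₁) ∑ w` and an error of small expectation. -/
theorem exists_abs_sub_sub_le_weightError {m₁ m₂ : ℝ} (hm₂ : 0 < m₂) (hm : m₂ < m₁) :
    ∃ K, 0 ≤ K ∧ ∀ (n : ℕ), 0 < n → ∀ (A : Set ℕ), A ⊆ Set.Ici 3 →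
      ∀ g : ℕ → ℝ, (∀ k, |g k| ≤ 1) → ∃ c : ℝ, ∀ w : Fin n → ℝ, (∀ i, 0 < w i) →
      |∑ H : SimpleGraph (Fin n), graphProb w H * g (cycleCount A H) -
        poissonExp g (limitMean A (m₂ / m₁)) -
        c * (∑ l, w l ^ 2 - m₂ / m₁ * ∑ l, w l)| ≤ K * weightError m₁ m₂ w := by
  have hm₁ : 0 < m₁ := hm₂.trans hm
  -- A third of the gap leaves room to perturb both means by `δ` and still have ratio `M < 1`.
  set δ := (m₁ - m₂) / 3 with hδ
  have hδ0 : 0 < δ := by rw [hδ]; linarith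
  set b := m₁ - δ with hb
  have hb0 : 0 < b := by rw [hb, hδ]; linarith
  set M := (m₂ + δ) / b with hM
  have hM0 : 0 < M := by positivity
  have hM1 : M < 1 := by
    rw [hM, div_lt_one hb0, hb, hδ]
    linarith
  set ρ := m₂ / m₁ with hρ
  have hρ0 : 0 ≤ ρ := by positivity
  have hρ1 : ρ ≤ 1 := by rw [hρ, div_le_one hm₁]; exact hm.le
  have hρM : ρ ≤ M := by
    rw [hρ, hM]
    have : b ≤ m₁ := by rw [hb]; linarith
    gcongr
    linarith
  obtain ⟨K₁, hK₁0, hK₁⟩ := exists_abs_sum_graphProb_sub_le hM0 hM1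
  obtain ⟨K₂, hK₂0, hK₂⟩ := exists_taylorBound_poissonExp_limitMean hM0 hM1
  have hKG : 0 ≤ K₁ * ((b ^ 3)⁻¹ + (b ^ 2)⁻¹) + K₂ * (2 / b ^ 2) + K₂ * (3 / (2 * b * m₁)) := by
    positivity
  have hKB : 0 ≤ 2 / δ ^ 2 + K₂ / m₁ * (1 / δ ^ 2 + 2) := by positivity
  refine ⟨(K₁ * ((b ^ 3)⁻¹ + (b ^ 2)⁻¹) + K₂ * (2 / b ^ 2) + K₂ * (3 / (2 * b * m₁))) +
    (2 / δ ^ 2 + K₂ / m₁ * (1 / δ ^ 2 + 2)), by positivity, ?_⟩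
  intro n hn A hA g hg
  obtain ⟨ψ', hψ⟩ := hK₂ A g hg
  have hn0 : (0 : ℝ) < n := by exact_mod_cast hn
  -- The linear coefficient of `S - ρ L`, with `L` in the denominator of `R - ρ = (S - ρ L) / L`
  -- replaced by its mean so that `c` does not depend on `w`.
  refine ⟨ψ' ρ / (n * m₁), fun w hw => ?_⟩
  have hρmem : ρ ∈ Set.Icc 0 M := ⟨hρ0, hρM⟩
  have hψ' : |ψ' ρ| ≤ K₂ := (hψ ρ hρmem ρ hρmem).2.1
  have hT := pairCubes_nonneg hw
  have hQ4 : 0 ≤ ∑ l, w l ^ 4 := Finset.sum_nonneg fun l _ => by positivity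
  have hL0 := sum_weights_pos hw ⟨0, hn⟩
  have hS20 : 0 ≤ ∑ l, w l ^ 2 := Finset.sum_nonneg fun l _ => sq_nonneg _
  have hq := abs_sum_graphProb_le_one hw A hg
  have hpg : |poissonExp g (limitMean A ρ)| ≤ 1 := abs_poissonExp_le hg
    (tsum_nonneg fun k => mul_nonneg (indicator_coeff_nonneg A k) (pow_nonneg hρ0 k))
  have hmain := hK₁ n A hA g hg w hw
  unfold weightError
  set q := ∑ H : SimpleGraph (Fin n), graphProb w H * g (cycleCount A H)
  set L := ∑ l, w l
  set S := ∑ l, w l ^ 2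
  set Q4 := ∑ l, w l ^ 4
  set T := pairCubes w
  set D := ((L - n * m₁) ^ 2 + (S - n * m₂) ^ 2) / (n : ℝ) ^ 2 with hD
  set E := T / (n : ℝ) ^ 3 + Q4 / (n : ℝ) ^ 2 with hE
  set Z := S - ρ * L with hZ
  have hE0 : 0 ≤ E := by positivity
  have hD0 : 0 ≤ D := by positivity
  have hDmul : (L - n * m₁) ^ 2 + (S - n * m₂) ^ 2 = D * n ^ 2 := by
    rw [hD]
    field_simp
  -- Since `ρ * m₁ = m₂`, the variable `Z` is a combination of the two centred sums.
  have hZ2 : Z ^ 2 ≤ 2 * D * n ^ 2 := by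
    have e : Z = (S - n * m₂) - ρ * (L - n * m₁) := by
      rw [hZ, hρ]
      field_simp
      ring
    have h1 : (ρ * (L - n * m₁)) ^ 2 ≤ (L - n * m₁) ^ 2 := by
      rw [mul_pow]
      exact mul_le_of_le_one_left (sq_nonneg _) (pow_le_one₀ hρ0 hρ1)
    rw [e, mul_assoc, ← hDmul]
    have h2 := two_mul_le_add_sq (S - n * m₂) (-(ρ * (L - n * m₁)))
    rw [neg_sq] at h2
    linarith [show (S - n * m₂ - ρ * (L - n * m₁)) ^ 2 = (S - n * m₂) ^ 2 +
      2 * (S - n * m₂) * -(ρ * (L - n * m₁)) + (ρ * (L - n * m₁)) ^ 2 by ring]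
  have comb : ∀ {a₁ a₂ a₃ a₄ : ℝ}, 0 ≤ a₁ → 0 ≤ a₂ → 0 ≤ a₃ → 0 ≤ a₄ →
      a₁ * E + a₂ * D + a₃ * D ≤ (a₁ + a₂ + a₃ + a₄) * (E + D) := by
    intro a₁ a₂ a₃ a₄ h₁ h₂ h₃ h₄
    linarith [mul_nonneg h₁ hD0, mul_nonneg h₂ hE0, mul_nonneg h₃ hE0, mul_nonneg h₄ hE0,
      mul_nonneg h₄ hD0, show (a₁ + a₂ + a₃ + a₄) * (E + D) = a₁ * E + a₂ * D + a₃ * D + a₁ * D +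
      a₂ * E + a₃ * E + a₄ * E + a₄ * D by ring]
  by_cases hgood : n * b ≤ L ∧ S ≤ n * (m₂ + δ)
  · obtain ⟨hLb, hSb⟩ := hgood
    have hnb : 0 < n * b := by positivity
    have hRM : S / L ≤ M := by
      rw [hM, div_le_div_iff₀ hL0 hb0]
      calc S * b ≤ n * (m₂ + δ) * b := by gcongr
        _ = (m₂ + δ) * (n * b) := by ring
        _ ≤ _ := by gcongr
    have hRmem : S / L ∈ Set.Icc 0 M := ⟨by positivity, hRM⟩
    have hRρ : S / L - ρ = Z / L := by
      rw [hZ]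
      field_simp
    have t1 : |q - poissonExp g (limitMean A (S / L))| ≤
        K₁ * ((b ^ 3)⁻¹ + (b ^ 2)⁻¹) * E := by
      refine (hmain hRM).trans ?_
      rw [mul_assoc]
      refine mul_le_mul_of_nonneg_left ?_ hK₁0
      have e1 : T / L ^ 3 ≤ (b ^ 3)⁻¹ * (T / n ^ 3) := by
        calc T / L ^ 3 ≤ T / (n * b) ^ 3 := by gcongr
          _ = _ := by
            rw [mul_pow]
            field_simp
      have e2 : Q4 / L ^ 2 ≤ (b ^ 2)⁻¹ * (Q4 / n ^ 2) := by
        calc Q4 / L ^ 2 ≤ Q4 / (n * b) ^ 2 := by gcongr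
          _ = _ := by
            rw [mul_pow]
            field_simp
      have e3 : 0 ≤ (b ^ 3)⁻¹ * (Q4 / n ^ 2) := by positivity
      have e4 : 0 ≤ (b ^ 2)⁻¹ * (T / n ^ 3) := by positivity
      rw [hE, add_mul, mul_add, mul_add]
      linarith
    have t2 : |poissonExp g (limitMean A (S / L)) - poissonExp g (limitMean A ρ) -
        ψ' ρ * (S / L - ρ)| ≤ K₂ * (2 / b ^ 2) * D := by
      refine (hψ _ hRmem ρ hρmem).2.2.trans ?_
      rw [mul_assoc]
      refine mul_le_mul_of_nonneg_left ?_ hK₂0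
      rw [hRρ, div_pow]
      calc Z ^ 2 / L ^ 2 ≤ 2 * D * n ^ 2 / (n * b) ^ 2 := by gcongr
        _ = _ := by
          rw [mul_pow]
          field_simp
    -- Replacing `L` by `n * m₁` costs a product of two fluctuations, `Z` and `n * m₁ - L`, which is
    -- again quadratic.
    have t3 : |ψ' ρ * (S / L - ρ) - ψ' ρ / (n * m₁) * Z| ≤ K₂ * (3 / (2 * b * m₁)) * D := by
      have e : ψ' ρ * (S / L - ρ) - ψ' ρ / (n * m₁) * Z =
          ψ' ρ * (Z * (n * m₁ - L) / (L * (n * m₁))) := by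
        rw [hRρ]
        field_simp
      rw [e, abs_mul, mul_assoc]
      refine mul_le_mul hψ' ?_ (abs_nonneg _) hK₂0
      rw [abs_div, abs_of_pos (a := L * (n * m₁)) (by positivity)]
      have h1 : |Z * (n * m₁ - L)| ≤ 3 / 2 * D * n ^ 2 := by
        have hy : (n * m₁ - L) ^ 2 ≤ D * n ^ 2 := by
          rw [← hDmul, sub_sq_comm]
          exact le_add_of_nonneg_right (sq_nonneg _)
        have e1 := two_mul_le_add_sq |Z| |n * m₁ - L|
        rw [sq_abs, sq_abs] at e1
        rw [abs_mul]
        linarith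
      calc |Z * (n * m₁ - L)| / (L * (n * m₁)) ≤ 3 / 2 * D * n ^ 2 / (n * b * (n * m₁)) := by
            gcongr
        _ = _ := by field_simp
    calc |q - poissonExp g (limitMean A ρ) - ψ' ρ / (n * m₁) * Z|
        = |(q - poissonExp g (limitMean A (S / L))) +
            (poissonExp g (limitMean A (S / L)) - poissonExp g (limitMean A ρ) -
              ψ' ρ * (S / L - ρ)) + (ψ' ρ * (S / L - ρ) - ψ' ρ / (n * m₁) * Z)| := by ring_nf
      _ ≤ K₁ * ((b ^ 3)⁻¹ + (b ^ 2)⁻¹) * E + K₂ * (2 / b ^ 2) * D +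
            K₂ * (3 / (2 * b * m₁)) * D :=
          (abs_add_three _ _ _).trans (add_le_add (add_le_add t1 t2) t3)
      _ ≤ _ := comb (by positivity) (by positivity) (by positivity) hKB
  -- Off the good event a pointwise Chebyshev argument applies: `D` is bounded below, so it
  -- dominates constants, and it dominates `|Z| / n` up to a constant.
  · have hDδ : δ ^ 2 ≤ D := by
      rw [hD, le_div_iff₀ (by positivity), ← mul_pow]
      rw [not_and_or, not_le, not_le] at hgood
      have hδn : 0 < δ * n := by positivity
      rcases hgood with h | h
      · have h' : δ * n ≤ n * m₁ - L := by rw [hb] at h; linarith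
        calc (δ * n) ^ 2 ≤ (n * m₁ - L) ^ 2 := by gcongr
          _ = (L - n * m₁) ^ 2 := sub_sq_comm _ _
          _ ≤ _ := le_add_of_nonneg_right (sq_nonneg _)
      · have h' : δ * n ≤ S - n * m₂ := by linarith
        calc (δ * n) ^ 2 ≤ (S - n * m₂) ^ 2 := by gcongr
          _ ≤ _ := le_add_of_nonneg_left (sq_nonneg _)
    have h1D : 1 ≤ 1 / δ ^ 2 * D := by
      rw [one_div, inv_mul_eq_div, one_le_div (by positivity)]
      exact hDδ
    have hZn : |Z| ≤ n * (1 + 2 * D) := by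
      have hn1 : |Z| ^ 2 ≤ 2 * D * n ^ 2 := by rwa [sq_abs]
      refine (sq_le_sq₀ (abs_nonneg _) (by positivity)).1 (hn1.trans ?_)
      have e1 : 2 * D ≤ (1 + 2 * D) ^ 2 := by
        have : 0 ≤ D ^ 2 := sq_nonneg D
        linarith [show (1 + 2 * D) ^ 2 = 1 + 4 * D + 4 * D ^ 2 by ring]
      rw [mul_pow, mul_comm ((n : ℝ) ^ 2)]
      exact mul_le_mul_of_nonneg_right e1 (sq_nonneg _)
    have t : |ψ' ρ / (n * m₁) * Z| ≤ K₂ / m₁ * (1 + 2 * D) := by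
      rw [abs_mul, abs_div, abs_of_pos (a := n * m₁) (by positivity)]
      calc |ψ' ρ| / (n * m₁) * |Z| ≤ K₂ / (n * m₁) * (n * (1 + 2 * D)) := by gcongr
        _ = _ := by field_simp
    calc |q - poissonExp g (limitMean A ρ) - ψ' ρ / (n * m₁) * Z|
        ≤ |q| + |poissonExp g (limitMean A ρ)| + |ψ' ρ / (n * m₁) * Z| :=
          (abs_sub _ _).trans (add_le_add_left (abs_sub _ _) _)
      _ ≤ 1 + 1 + K₂ / m₁ * (1 + 2 * D) := add_le_add (add_le_add hq hpg) t
      _ ≤ 2 * (1 / δ ^ 2 * D) + K₂ / m₁ * (1 / δ ^ 2 * D + 2 * D) := by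
          have : 0 ≤ K₂ / m₁ := by positivity
          gcongr
          linarith
      _ = (2 / δ ^ 2 + K₂ / m₁ * (1 / δ ^ 2 + 2)) * D := by ring
      _ ≤ _ := by
          refine mul_le_mul (le_add_of_nonneg_left hKG) (le_add_of_nonneg_left hE0) hD0 ?_
          exact add_nonneg hKG hKB

/-! ### Integration over the weights -/

section Weights

variable {μ : Measure ℝ} [IsProbabilityMeasure μ]

theorem integrable_pow_of_integrable_pow_four (h4 : Integrable (fun x : ℝ => x ^ 4) μ) {k : ℕ}
    (hk : k ≤ 4) : Integrable (fun x : ℝ => x ^ k) μ := by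
  refine Integrable.mono' ((integrable_const (1 : ℝ)).add h4)
    (measurable_id.pow_const k).aestronglyMeasurable (Filter.Eventually.of_forall fun x => ?_)
  simp only [Pi.add_apply]
  rw [norm_pow, Real.norm_eq_abs, ← (by norm_num : Even 4).pow_abs x]
  rcases le_total |x| 1 with h | h
  · exact (pow_le_one₀ (abs_nonneg x) h).trans (le_add_of_nonneg_right (by positivity))
  · exact (pow_le_pow_right₀ h hk).trans (le_add_of_nonneg_left zero_le_one)

theorem integrable_eval {f : ℝ → ℝ} (hf : Integrable f μ) (i : Fin n) :
    Integrable (fun w : Fin n → ℝ => f (w i)) (Measure.pi fun _ : Fin n => μ) :=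
  (measurePreserving_eval (fun _ : Fin n => μ) i).integrable_comp_of_integrable hf

theorem integral_eval {f : ℝ → ℝ} (hf : Integrable f μ) (i : Fin n) :
    ∫ w : Fin n → ℝ, f (w i) ∂(Measure.pi fun _ : Fin n => μ) = ∫ x, f x ∂μ :=
  integral_comp_eval (μ := fun _ : Fin n => μ) hf.aestronglyMeasurable

theorem integral_sum_eval {f : ℝ → ℝ} (hf : Integrable f μ) :
    ∫ w : Fin n → ℝ, ∑ i, f (w i) ∂(Measure.pi fun _ : Fin n => μ) = n * ∫ x, f x ∂μ := by
  rw [integral_finsetSum _ fun i _ => integrable_eval hf i]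
  simp [integral_eval hf]

theorem integrable_integral_mul_eval {f : ℝ → ℝ} (hf : Integrable f μ) {i j : Fin n}
    (hij : i ≠ j) :
    Integrable (fun w : Fin n → ℝ => f (w i) * f (w j)) (Measure.pi fun _ : Fin n => μ) ∧
    ∫ w : Fin n → ℝ, f (w i) * f (w j) ∂(Measure.pi fun _ : Fin n => μ) = (∫ x, f x ∂μ) ^ 2 := by
  have hind : iIndepFun (fun i (w : Fin n → ℝ) => f (w i)) (Measure.pi fun _ : Fin n => μ) :=
    iIndepFun_pi fun _ => hf.aemeasurable
  have h := hind.indepFun hij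
  refine ⟨h.integrable_mul (integrable_eval hf i) (integrable_eval hf j), ?_⟩
  rw [h.integral_fun_mul_eq_mul_integral (integrable_eval hf i).aestronglyMeasurable
    (integrable_eval hf j).aestronglyMeasurable, integral_eval hf, integral_eval hf, sq]

theorem integrable_integral_sq_sub_le {f : ℝ → ℝ} (hf : MemLp f 2 μ) :
    Integrable (fun w : Fin n → ℝ => (∑ i, f (w i) - n * ∫ x, f x ∂μ) ^ 2)
      (Measure.pi fun _ : Fin n => μ) ∧
    ∫ w : Fin n → ℝ, (∑ i, f (w i) - n * ∫ x, f x ∂μ) ^ 2 ∂(Measure.pi fun _ : Fin n => μ) ≤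
      n * ∫ x, f x ^ 2 ∂μ := by
  have hf1 : Integrable f μ := hf.integrable (by norm_num)
  have hmem : MemLp (fun w : Fin n → ℝ => ∑ i, f (w i)) 2 (Measure.pi fun _ : Fin n => μ) :=
    memLp_finsetSum _ fun i _ => hf.comp_measurePreserving
      (measurePreserving_eval (fun _ : Fin n => μ) i)
  refine ⟨(hmem.sub (memLp_const _)).integrable_sq, ?_⟩
  have hvar : Var[fun w : Fin n → ℝ => ∑ i, f (w i); Measure.pi fun _ : Fin n => μ] =
      n * Var[f; μ] := by
    have h := variance_sum_pi (μ := fun _ : Fin n => μ) (X := fun _ => f) fun _ => hf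
    have e : (∑ i, fun w : Fin n → ℝ => f (w i)) = fun w : Fin n → ℝ => ∑ i, f (w i) := by
      ext w
      simp
    rw [e] at h
    rw [h]
    simp
  rw [variance_eq_integral hmem.aemeasurable, integral_sum_eval hf1] at hvar
  rw [hvar]
  exact mul_le_mul_of_nonneg_left (variance_le_expectation_sq hf.aestronglyMeasurable)
    (Nat.cast_nonneg n)

/-- Independence turns off-diagonal cubes into `(E W³)²`, and `n ^ 2` pairs over `n ^ 3` leave `1 /
n`; the squared deviations are variances of sums, linear in `n`, divided by `n ^ 2`. -/
theorem integrable_integral_weightError_le (h4 : Integrable (fun x : ℝ => x ^ 4) μ)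
    (hn : 0 < n) :
    Integrable (weightError (n := n) (∫ x, x ∂μ) (∫ x, x ^ 2 ∂μ)) (Measure.pi fun _ => μ) ∧
    ∫ w : Fin n → ℝ, weightError (∫ x, x ∂μ) (∫ x, x ^ 2 ∂μ) w ∂(Measure.pi fun _ => μ) ≤
      ((∫ x, x ^ 3 ∂μ) ^ 2 + 2 * ∫ x, x ^ 4 ∂μ + ∫ x, x ^ 2 ∂μ) / n := by
  have i2 := integrable_pow_of_integrable_pow_four h4 (k := 2) (by norm_num)
  have i3 := integrable_pow_of_integrable_pow_four h4 (k := 3) (by norm_num)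
  have l1 : MemLp (fun x : ℝ => x) 2 μ :=
    (memLp_two_iff_integrable_sq measurable_id.aestronglyMeasurable).2 i2
  have l2 : MemLp (fun x : ℝ => x ^ 2) 2 μ :=
    (memLp_two_iff_integrable_sq (measurable_id.pow_const 2).aestronglyMeasurable).2
      (by simpa only [id, ← pow_mul] using h4)
  have hn0 : (0 : ℝ) < n := by exact_mod_cast hn
  have c1 := integrable_integral_sq_sub_le (n := n) l1
  have c2 := integrable_integral_sq_sub_le (n := n) l2
  simp only [← pow_mul, Nat.reduceMul] at c2
  have hpi : ∀ a b : Fin n, Integrable (fun w : Fin n → ℝ =>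
      if a = b then 0 else w a ^ 3 * w b ^ 3) (Measure.pi fun _ => μ) := fun a b => by
    by_cases h : a = b
    · simp [h]
    · simp only [h, if_false]
      exact (integrable_integral_mul_eval i3 h).1
  have p1 : Integrable (pairCubes (n := n)) (Measure.pi fun _ => μ) :=
    integrable_finsetSum _ fun a _ => integrable_finsetSum _ fun b _ => hpi a b
  have p2 : ∫ w : Fin n → ℝ, pairCubes w ∂(Measure.pi fun _ => μ) ≤
      n ^ 2 * (∫ x, x ^ 3 ∂μ) ^ 2 := by
    unfold pairCubes
    rw [integral_finsetSum _ fun a _ => integrable_finsetSum _ fun b _ => hpi a b]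
    calc _ ≤ ∑ a : Fin n, ∑ b : Fin n, (∫ x, x ^ 3 ∂μ) ^ 2 := by
          refine Finset.sum_le_sum fun a _ => ?_
          rw [integral_finsetSum _ fun b _ => hpi a b]
          refine Finset.sum_le_sum fun b _ => ?_
          by_cases h : a = b
          · simp [h, sq_nonneg]
          · simp only [h, if_false]
            exact (integrable_integral_mul_eval i3 h).2.le
      _ = _ := by
          simp
          ring
  have f1 : Integrable (fun w : Fin n → ℝ => ∑ l, w l ^ 4) (Measure.pi fun _ => μ) :=
    integrable_finsetSum _ fun i _ => integrable_eval h4 i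
  have f2 := integral_sum_eval (n := n) h4
  have c3 : Integrable (fun w : Fin n → ℝ => ((∑ l, w l - n * ∫ x, x ∂μ) ^ 2 +
      (∑ l, w l ^ 2 - n * ∫ x, x ^ 2 ∂μ) ^ 2) / (n : ℝ) ^ 2) (Measure.pi fun _ => μ) :=
    (c1.1.add c2.1).div_const _
  have f3 : Integrable (fun w : Fin n → ℝ => pairCubes w / (n : ℝ) ^ 3 +
      (∑ l, w l ^ 4) / (n : ℝ) ^ 2) (Measure.pi fun _ => μ) :=
    (p1.div_const _).add (f1.div_const _)
  refine ⟨f3.add c3, ?_⟩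
  unfold weightError
  rw [integral_add f3 c3, integral_add (p1.div_const _) (f1.div_const _), integral_div, integral_div,
    integral_div,
    integral_add c1.1 c2.1, f2]
  calc _ ≤ n ^ 2 * (∫ x, x ^ 3 ∂μ) ^ 2 / n ^ 3 + n * (∫ x, x ^ 4 ∂μ) / n ^ 2 +
        (n * (∫ x, x ^ 2 ∂μ) + n * (∫ x, x ^ 4 ∂μ)) / n ^ 2 := by
        gcongr
        · exact c1.2
        · exact c2.2
    _ = _ := by
        field_simp
        ring

theorem ae_pi_pos (hpos : ∀ᵐ x ∂μ, 0 < x) :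
    ∀ᵐ w ∂(Measure.pi fun _ : Fin n => μ), ∀ i, 0 < w i :=
  ae_all_iff.2 fun i =>
    (measurePreserving_eval (fun _ : Fin n => μ) i).quasiMeasurePreserving.ae hpos

/-- The coefficient `c` may depend on `n`, `A` and `g` but not on the weights, so the linear term
integrates to zero and only the weight error survives. -/
theorem exists_abs_integral_sub_le (hpos : ∀ᵐ x ∂μ, 0 < x)
    (h4 : Integrable (fun x : ℝ => x ^ 4) μ) (hm₂ : 0 < ∫ x, x ^ 2 ∂μ)
    (hm : ∫ x, x ^ 2 ∂μ < ∫ x, x ∂μ) :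
    ∃ C, 0 ≤ C ∧ ∀ n : ℕ, 0 < n → ∀ A : Set ℕ, A ⊆ Set.Ici 3 →
      ∀ g : ℕ → ℝ, (∀ k, |g k| ≤ 1) →
      |∫ w : Fin n → ℝ, ∑ H : SimpleGraph (Fin n), graphProb w H * g (cycleCount A H)
          ∂(Measure.pi fun _ => μ) -
        poissonExp g (limitMean A ((∫ x, x ^ 2 ∂μ) / ∫ x, x ∂μ))| ≤ C / n := by
  obtain ⟨K, hK0, hK⟩ := exists_abs_sub_sub_le_weightError hm₂ hm
  have i2 := integrable_pow_of_integrable_pow_four h4 (k := 2) (by norm_num)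
  have i1 : Integrable (fun x : ℝ => x) μ := by
    simpa using integrable_pow_of_integrable_pow_four h4 (k := 1) (by norm_num)
  have hm40 : 0 ≤ ∫ x, x ^ 4 ∂μ := integral_nonneg fun x => by positivity
  refine ⟨K * ((∫ x, x ^ 3 ∂μ) ^ 2 + 2 * ∫ x, x ^ 4 ∂μ + ∫ x, x ^ 2 ∂μ), by positivity, ?_⟩
  intro n hn A hA g hg
  obtain ⟨c, hc⟩ := hK n hn A hA g hg
  obtain ⟨hE1, hE2⟩ := integrable_integral_weightError_le h4 hn
  set ν := Measure.pi fun _ : Fin n => μ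
  set ρ := (∫ x, x ^ 2 ∂μ) / ∫ x, x ∂μ with hρ
  have hq : Integrable (fun w : Fin n → ℝ =>
      ∑ H : SimpleGraph (Fin n), graphProb w H * g (cycleCount A H)) ν := by
    refine Integrable.mono' (integrable_const (1 : ℝ)) ?_ ?_
    · exact (Finset.measurable_sum _ fun H _ =>
        (measurable_graphProb H).mul_const _).aestronglyMeasurable
    · filter_upwards [ae_pi_pos hpos] with w hw
      exact abs_sum_graphProb_le_one hw A hg
  have s2 : Integrable (fun w : Fin n → ℝ => ∑ l, w l ^ 2) ν :=
    integrable_finsetSum _ fun i _ => integrable_eval i2 i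
  have s1 : Integrable (fun w : Fin n → ℝ => ∑ l, w l) ν :=
    integrable_finsetSum _ fun i _ => integrable_eval i1 i
  have hZ : Integrable (fun w : Fin n → ℝ => c * (∑ l, w l ^ 2 - ρ * ∑ l, w l)) ν :=
    (s2.sub (s1.const_mul ρ)).const_mul c
  have hZ0 : ∫ w : Fin n → ℝ, c * (∑ l, w l ^ 2 - ρ * ∑ l, w l) ∂ν = 0 := by
    rw [integral_const_mul, integral_sub s2 (s1.const_mul ρ), integral_const_mul,
      integral_sum_eval i2, integral_sum_eval i1, hρ]
    have : (∫ x, x ∂μ) ≠ 0 := (hm₂.trans hm).ne'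
    field_simp
    ring
  have hq' : Integrable (fun w : Fin n → ℝ =>
      ∑ H : SimpleGraph (Fin n), graphProb w H * g (cycleCount A H) -
        poissonExp g (limitMean A ρ)) ν := hq.sub (integrable_const _)
  have key : ∫ w : Fin n → ℝ, ∑ H : SimpleGraph (Fin n), graphProb w H * g (cycleCount A H) ∂ν -
      poissonExp g (limitMean A ρ) =
      ∫ w : Fin n → ℝ, (∑ H : SimpleGraph (Fin n), graphProb w H * g (cycleCount A H) -
        poissonExp g (limitMean A ρ) - c * (∑ l, w l ^ 2 - ρ * ∑ l, w l)) ∂ν := by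
    rw [integral_sub hq' hZ, hZ0, sub_zero,
      integral_sub hq (integrable_const _)]
    simp
  rw [key]
  calc _ ≤ ∫ w, K * weightError (∫ x, x ∂μ) (∫ x, x ^ 2 ∂μ) w ∂ν := by
        rw [← Real.norm_eq_abs]
        refine norm_integral_le_of_norm_le (hE1.const_mul K) ?_
        filter_upwards [ae_pi_pos hpos] with w hw
        exact hc w hw
    _ ≤ K * (((∫ x, x ^ 3 ∂μ) ^ 2 + 2 * ∫ x, x ^ 4 ∂μ + ∫ x, x ^ 2 ∂μ) / n) := by
        rw [integral_const_mul]
        gcongr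
    _ = _ := by ring

end Weights

/-! ### The law of the number of cycles -/

/-- A graph is determined by its adjacency relation, so singletons are preimages of singletons. -/
instance : DiscreteMeasurableSpace (SimpleGraph (Fin n)) := by
  refine @MeasurableSingletonClass.toDiscreteMeasurableSpace _ _ ⟨fun H => ?_⟩ _
  refine ⟨{H.Adj}, measurableSet_singleton _, ?_⟩
  ext G
  simp

theorem numCycles_eq_card (H : SimpleGraph (Fin n)) (m : ℕ) [DecidablePred fun
    α : Fin (m + 3) → Fin n => α ∈ possibleCycles n m ∧ ∀ i, H.Adj (α i) (α (i + 1))] :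
    numCycles H m = (Finset.univ.filter fun α : Fin (m + 3) → Fin n =>
      α ∈ possibleCycles n m ∧ ∀ i, H.Adj (α i) (α (i + 1))).card := by
  rw [numCycles, ← Set.ncard_coe_finset]
  congr 1
  ext α
  simp

theorem cycleProcess_apply (H : SimpleGraph (Fin n)) (A : Set ℕ) :
    cycleProcess H A = cycleCount A H := by
  classical
  have h1 : cycleProcess H A = ∑ k ∈ Finset.range n,
      if k + 3 ∈ A then (numCycles H k : ℝ≥0∞) else 0 := by
    rw [cycleProcess, Measure.sum_apply _ MeasurableSet.of_discrete, tsum_eq_sum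
      (s := Finset.range n)]
    · refine Finset.sum_congr rfl fun k _ => ?_
      rw [Measure.smul_apply, Measure.dirac_apply' _ MeasurableSet.of_discrete]
      by_cases h : k + 3 ∈ A <;> simp [h]
    -- A cycle of length `k + 3` with `k ≥ n` would need more than `n` distinct vertices.
    · intro k hk
      have h0 : numCycles H k = 0 := by
        rw [numCycles_eq_card, Finset.card_eq_zero, Finset.filter_eq_empty_iff]
        rintro α - ⟨⟨hα, -⟩, -⟩
        have := Fintype.card_le_of_injective α hα
        simp only [Fintype.card_fin] at this
        rw [Finset.mem_range] at hk
        omega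
      simp [h0]
  have h2 : cycleCount A H = ∑ k ∈ Finset.range n, if k + 3 ∈ A then numCycles H k else 0 := by
    rw [cycleCount, Finset.card_filter]
    refine (sum_cyclesIn A fun k α => if ∀ i, H.Adj (α i) (α (i + 1)) then 1 else 0).trans ?_
    rw [Finset.sum_filter]
    refine Finset.sum_congr rfl fun k _ => ?_
    split_ifs
    · rw [numCycles_eq_card, ← Finset.card_filter, Finset.filter_filter]
    · rfl
  rw [h1, h2]
  push_cast
  rfl

theorem setOf_cycleProcess_eq (A B : Set ℕ) :
    {G : SimpleGraph (Fin n) | ∃ k ∈ B, cycleProcess G A = (k : ℝ≥0∞)} =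
      {G | cycleCount A G ∈ B} := by
  ext G
  simp [cycleProcess_apply]

theorem graphKernel_apply {w : Fin n → ℝ} (hw : ∀ i, 0 < w i) (A B : Set ℕ) :
    graphKernel n w {G | cycleCount A G ∈ B} =
      ENNReal.ofReal (∑ H : SimpleGraph (Fin n), graphProb w H *
        B.indicator (fun _ => 1) (cycleCount A H)) := by
  classical
  have h0 : ∀ H : SimpleGraph (Fin n), 0 ≤ graphProb w H *
      B.indicator (fun _ => (1 : ℝ)) (cycleCount A H) := fun H =>
    mul_nonneg (graphProb_nonneg hw H) (Set.indicator_nonneg (fun _ _ => zero_le_one) _)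
  change (Measure.sum fun H => ENNReal.ofReal (graphProb w H) • Measure.dirac H) _ = _
  rw [Measure.sum_apply _ MeasurableSet.of_discrete, tsum_fintype,
    ENNReal.ofReal_sum_of_nonneg fun H _ => h0 H]
  refine Finset.sum_congr rfl fun H _ => ?_
  rw [Measure.smul_apply, Measure.dirac_apply' _ MeasurableSet.of_discrete]
  by_cases h : cycleCount A H ∈ B <;> simp [h]

theorem grgLaw_real_eq {μ : Measure ℝ} [IsProbabilityMeasure μ] (hpos : ∀ᵐ x ∂μ, 0 < x)
    (A B : Set ℕ) :
    (grgLaw μ n).real {G | ∃ k ∈ B, cycleProcess G A = (k : ℝ≥0∞)} =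
      ∫ w : Fin n → ℝ, ∑ H : SimpleGraph (Fin n), graphProb w H *
        B.indicator (fun _ => 1) (cycleCount A H) ∂(Measure.pi fun _ => μ) := by
  rw [setOf_cycleProcess_eq, Measure.real, grgLaw,
    Measure.bind_apply MeasurableSet.of_discrete (graphKernel n).measurable.aemeasurable]
  have hae : ∀ᵐ w ∂(Measure.pi fun _ : Fin n => μ), 0 ≤ ∑ H : SimpleGraph (Fin n),
      graphProb w H * B.indicator (fun _ => (1 : ℝ)) (cycleCount A H) := by
    filter_upwards [ae_pi_pos hpos] with w hw
    exact Finset.sum_nonneg fun H _ => mul_nonneg (graphProb_nonneg hw H)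
      (Set.indicator_nonneg (fun _ _ => zero_le_one) _)
  rw [integral_eq_lintegral_of_nonneg_ae hae]
  · congr 1
    refine lintegral_congr_ae ?_
    filter_upwards [ae_pi_pos hpos] with w hw
    exact graphKernel_apply hw A B
  · exact (Finset.measurable_sum _ fun H _ =>
      (measurable_graphProb H).mul_const _).aestronglyMeasurable

theorem cycleIntensity_apply {Ω : Type*} [MeasurableSpace Ω] {P : Measure Ω} {W : Ω → ℝ}
    {ρ : ℝ} (hρ : (∫ ω, W ω ^ 2 ∂P) / ∫ ω, W ω ∂P = ρ) (h0 : 0 ≤ ρ) (h1 : ρ < 1)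
    {A : Set ℕ} (hA : A ⊆ Set.Ici 3) :
    cycleIntensity P W A = ENNReal.ofReal (limitMean A ρ) := by
  classical
  have h := hasSum_limitMean hA h0 h1
  rw [← h.tsum_eq, ENNReal.ofReal_tsum_of_nonneg
    (fun k => mul_nonneg (indicator_coeff_nonneg A _) (pow_nonneg h0 _)) h.summable,
    cycleIntensity, Measure.sum_apply _ MeasurableSet.of_discrete]
  congr 1
  ext k
  rw [Measure.smul_apply, Measure.dirac_apply' _ MeasurableSet.of_discrete, hρ]
  by_cases hk : k + 3 ∈ A <;> simp [hk]

theorem poissonMeasure_real_eq (r : ℝ≥0) (B : Set ℕ) :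
    (poissonMeasure r).real B = poissonExp (B.indicator fun _ => 1) r := by
  have h := integral_poissonMeasure r (B.indicator fun _ => (1 : ℝ))
  rw [integral_indicator MeasurableSet.of_discrete, setIntegral_const, smul_eq_mul, mul_one] at h
  rw [h, poissonExp]
  refine tsum_congr fun k => ?_
  rw [smul_eq_mul]
  ring

theorem poissonPointProcess_real_eq {Ω : Type*} [MeasurableSpace Ω] {Q : Measure Ω}
    {Λ : Measure ℕ} {η : Ω → Measure ℕ} (hη : IsPoissonPointProcess Q Λ η) {A : Set ℕ}
    (hA : Λ A ≠ ∞) (B : Set ℕ) :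
    Q.real {ω | ∃ k ∈ B, η ω A = (k : ℝ≥0∞)} =
      poissonExp (B.indicator fun _ => 1) (Λ A).toReal := by
  have hS : MeasurableSet {x : ℝ≥0∞ | ∃ k ∈ B, x = (k : ℝ≥0∞)} := by
    have : {x : ℝ≥0∞ | ∃ k ∈ B, x = (k : ℝ≥0∞)} = (fun k : ℕ => (k : ℝ≥0∞)) '' B := by
      ext x
      simp [eq_comm]
    rw [this]
    exact (B.to_countable.image _).measurableSet
  have hmeas : Measurable fun ω => η ω A :=
    (Measure.measurable_coe MeasurableSet.of_discrete).comp hη.measurable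
  have hlaw := hη.law A MeasurableSet.of_discrete hA
  have h1 : Q {ω | ∃ k ∈ B, η ω A = (k : ℝ≥0∞)} = poissonMeasure (Λ A).toNNReal B := by
    have h2 := congrArg (fun ν => ν {x : ℝ≥0∞ | ∃ k ∈ B, x = (k : ℝ≥0∞)}) hlaw
    rw [Measure.map_apply hmeas hS, Measure.map_apply (by fun_prop) hS] at h2
    have e : (fun k : ℕ => (k : ℝ≥0∞)) ⁻¹' {x : ℝ≥0∞ | ∃ k ∈ B, x = (k : ℝ≥0∞)} = B := by
      ext k
      simp
    rw [e] at h2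
    exact h2
  rw [Measure.real, h1, ← Measure.real, poissonMeasure_real_eq, ENNReal.coe_toNNReal_eq_toReal]

end GenRandGraph

end

/-! ### The total variation bound -/

theorem theorem2p4 {Ω Ω' : Type*} [MeasurableSpace Ω] [MeasurableSpace Ω']
    (P : Measure Ω) [IsProbabilityMeasure P] (W : Ω → ℝ) (hW : AEMeasurable W P)
    (hpos : ∀ᵐ ω ∂P, 0 < W ω)
    (hW4 : Integrable (fun ω => W ω ^ 4) P)
    (hsub : ∫ ω, W ω ^ 2 ∂P < ∫ ω, W ω ∂P)
    (Q : Measure Ω') [IsProbabilityMeasure Q] (η : Ω' → Measure ℕ)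
    (hη : GenRandGraph.IsPoissonPointProcess Q (GenRandGraph.cycleIntensity P W) η) :
    ∃ C : ℝ, 0 < C ∧ ∀ n : ℕ, 3 ≤ n → ∀ A : Set ℕ, A ⊆ Set.Ici 3 →
      GenRandGraph.tvDist (GenRandGraph.grgLaw (P.map W) n)
          (fun G => GenRandGraph.cycleProcess G A) Q (fun ω => η ω A) ≤
        C * Real.log n ^ 3 / n := by
  have hprob : IsProbabilityMeasure (P.map W) := Measure.isProbabilityMeasure_map hW
  have hpos' : ∀ᵐ x ∂(P.map W), 0 < x :=
    (ae_map_iff hW measurableSet_Ioi).2 hpos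
  have h4 : Integrable (fun x : ℝ => x ^ 4) (P.map W) :=
    (integrable_map_measure (measurable_id.pow_const 4).aestronglyMeasurable hW).2 hW4
  have e2 : ∫ x, x ^ 2 ∂(P.map W) = ∫ ω, W ω ^ 2 ∂P :=
    integral_map hW (measurable_id.pow_const 2).aestronglyMeasurable
  have e1 : ∫ x, x ∂(P.map W) = ∫ ω, W ω ∂P :=
    integral_map hW measurable_id.aestronglyMeasurable
  have i2 := GenRandGraph.integrable_pow_of_integrable_pow_four h4 (k := 2) (by norm_num)
  -- A vanishing second moment would force `W = 0` almost surely, against positivity.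
  have hm₂ : 0 < ∫ x, x ^ 2 ∂(P.map W) := by
    refine lt_of_le_of_ne (integral_nonneg fun x => sq_nonneg x) fun h => ?_
    have h0 := (integral_eq_zero_iff_of_nonneg (fun x => sq_nonneg x) i2).1 h.symm
    have hfalse : ∀ᵐ _ ∂(P.map W), False := by
      filter_upwards [h0, hpos'] with x hx hx'
      exact (pow_pos hx' 2).ne' hx
    exact hfalse.exists.elim fun _ h => h
  have hm : ∫ x, x ^ 2 ∂(P.map W) < ∫ x, x ∂(P.map W) := by rw [e1, e2]; exact hsub
  have hm₁ := hm₂.trans hm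
  obtain ⟨C, hC0, hC⟩ := GenRandGraph.exists_abs_integral_sub_le hpos' h4 hm₂ hm
  refine ⟨C + 1, by linarith, fun n hn A hA => ?_⟩
  have hΛ := GenRandGraph.cycleIntensity_apply (P := P) (W := W) (by rw [← e1, ← e2])
    (div_pos hm₂ hm₁).le ((div_lt_one hm₁).2 hm) hA
  have hn3 : (3 : ℝ) ≤ n := by exact_mod_cast hn
  have hn0 : (0 : ℝ) < n := by linarith
  -- Here `n ≥ 3 > e` is used; it lets the logarithmic factor be inserted for free.
  have hlog : 1 ≤ Real.log n := by
    rw [Real.le_log_iff_exp_le hn0]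
    linarith [Real.exp_one_lt_d9]
  have hbound : C / n ≤ (C + 1) * Real.log n ^ 3 / n := by
    gcongr
    nlinarith [one_le_pow₀ hlog (n := 3)]
  -- Indicators of sets `B` are admissible test functions `g`, and the bound is uniform in them.
  refine ciSup_le fun B => le_trans (le_of_eq ?_) ((hC n (by omega) A hA
    (B.indicator fun _ => 1) fun k => ?_).trans hbound)
  · rw [GenRandGraph.grgLaw_real_eq hpos', GenRandGraph.poissonPointProcess_real_eq hη
      (by rw [hΛ]; exact ENNReal.ofReal_ne_top), hΛ, ENNReal.toReal_ofReal]
    exact tsum_nonneg fun k => mul_nonneg (GenRandGraph.indicator_coeff_nonneg A k)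
      (pow_nonneg (div_pos hm₂ hm₁).le k)
  · by_cases hk : k ∈ B <;> simp [hk]
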